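/- Let $Act$ be a set of actions and let processes be the states of a labelled transition system over $Act$; $p$ is image-finite if for every state $p'$ reachable from $p$ and every $a\in Act$ the set $\{p''\mid p'\xrightarrow{a}p''\}$ is finite. Hennessy--Milner formulas are built from conjunctions $\bigwedge_{i\in I}\varphi_i$ over arbitrary index sets, prefixes $a\varphi$ and negations $\neg\varphi$, with the usual satisfaction relation; $\top$ is the empty conjunction and $0=\bigwedge_{a\in Act}\neg a\top$. A set $\mathcal L$ of formulas induces the preorder $p\sqsubseteq_{\mathcal L}q$ iff every $\varphi\in\mathcal L$ satisfied by $p$ is satisfied by $q$. *Constraints.* For $N\in\{U,C,I,T,S\}$ let $\mathcal L'_U=\{\top\}$, $\mathcal L'_C=\{\top,\neg 0\}$, $\mathcal L'_I=\{\top,\neg 0\}\cup\{a\top\mid a\in Act\}$, let $\mathcal L'_T$ be the least set containing $\top$ and closed under $\varphi\mapsto a\varphi$, and $\mathcal L'_S=\mathcal L'_{US}$ (defined next). Let $\mathcal L_N^{\equiv}$, $\mathcal L_N^{\neg}$, $\mathcal L_N^{\surd}$ be the closures under arbitrary conjunctions of $\{\sigma,\neg\sigma\mid\sigma\in\mathcal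 L'_N\}$, $\{\neg\sigma\mid\sigma\in\mathcal L'_N\}$ and $\mathcal L'_N$. *Logics.* The following are the least sets of formulas such that: - $\mathcal L'_{NS}$ ($N$-simulation) contains $\sigma$ and $\neg\sigma$ for $\sigma\in\mathcal L'_N$ and is closed under arbitrary conjunctions and prefixes; - $\mathcal L'_{\leq_N^{l}}$ ($N$-ready trace), $\mathcal L'_{\leq_N^{l\supseteq}}$ ($N$-failure trace), $\mathcal L'_{\leq_N^{l\subseteq}}$ (partial offer trace) contain $\top$ and are closed under prefixes and under $\varphi\mapsto\sigma\wedge\varphi$ for $\sigma$ in $\mathcal L_N^{\equiv}$, $\mathcal L_N^{\neg}$, $\mathcal L_N^{\surd}$, respectively; - $\mathcal L'_{\leq_N^{lf}}$ ($N$-readiness), $\mathcal L'_{\leq_N^{lf\supseteq}}$ ($N$-failures), $\mathcal L'_{\leq_N^{lf\subseteq}}$ (partial offers) contain $\top$ and all of $\mathcal L_N^{\equiv}$, $\mathcal L_N^{\neg}$, $\mathcal L_N^{\surd}$, respectively, and are closed under prefixes; - $\mathcal L'_{D_N}$ (deterministic branching) contains $\top$ and is closed under $\varphi\mapsto\sigma\wedge\varphi$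 for $\sigma\in\mathcal L_N^{\equiv}$ and under forming $\bigwedge_{a\in X}a\varphi_a$ for $X\subseteq Act$. The finitary fragment $\mathcal L^f_{\mathcal Y_N}$ consists of the formulas of $\mathcal L'_{\mathcal Y_N}$ all of whose conjunctions are finite. *Observations.* The local observation $L_N(p)$ is: trivial for $U$; for $C$, the truth value of "$p$ has no transition"; for $I$, the set of initial actions of $p$; for $T$, the set of traces of $p$; for $S$, the simulation-equivalence class of $p$. The set $BGO_N(p)$ of branching general observations consists of the finite trees $\langle L_N(p),S\rangle$ with $S$ a finite set of pairs $(a,o)$ such that $o\in BGO_N(p')$ for some $p\xrightarrow{a}p'$; $dBGO_N(p)$ is the set of those in which distinct children of a node always have distinct arc labels; $LGO_N(p)$ is the set of those in which every node has at most one child, written $X_0a_1X_1\dots a_nX_n$. On local observations, $X\supseteq Y$ means equality for $N\in\{U,C\}$, set inclusion for $N\in\{I,T\}$, and $Y\leq_S X$ in the simulation order on classes for $N=S$; $X\subseteq Y$ means equality for $N=U$, set inclusion for $N\in\{I,T\}$, $X\leq_S Y$ for $N=S$, and, for $N=C$, that if $Y$ is the observation of a terminated process then so is $X$. *Observational preorders.*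 For $NS$: $BGO_N(p)\subseteq BGO_N(q)$. For $D_N$: $dBGO_N(p)\subseteq dBGO_N(q)$. For $\leq_N^l$: $LGO_N(p)\subseteq LGO_N(q)$. For $\leq_N^{l\supseteq}$, $\leq_N^{l\subseteq}$, $\leq_N^{lf}$, $\leq_N^{lf\supseteq}$, $\leq_N^{lf\subseteq}$: for every $X_0a_1X_1\dots a_nX_n\in LGO_N(p)$ there is $Y_0a_1Y_1\dots a_nY_n\in LGO_N(q)$ (same actions) with, respectively, $X_i\supseteq Y_i$ for all $i\le n$; $X_i\subseteq Y_i$ for all $i\le n$; $X_n=Y_n$; $X_n\supseteq Y_n$; $X_n\subseteq Y_n$. **Theorem.** Let $N\in\{U,C,I,T,S\}$ and $\mathcal Y_N\in\{NS,\leq_N^{l},\leq_N^{l\supseteq},\leq_N^{lf},\leq_N^{lf\supseteq},\leq_N^{l\subseteq},\leq_N^{lf\subseteq},D_N\}$, and let $p,q$ be image-finite processes. Then: 1. $p\sqsubseteq_{\mathcal L'_{\mathcal Y_N}}q$ if and only if $p$ is below $q$ in the observational preorder of $\mathcal Y_N$; 2. if moreover $Act$ is finite in case $N=C$, then $p\sqsubseteq_{\mathcal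 L^f_{\mathcal Y_N}}q$ if and only if $p$ is below $q$ in the observational preorder of $\mathcal Y_N$; 3. the observational preorder is also the inclusion of the sets of observations of $p$ and $q$, where for $\leq_N^{l\supseteq}$, $\leq_N^{l\subseteq}$, $\leq_N^{lf}$, $\leq_N^{lf\supseteq}$, $\leq_N^{lf\subseteq}$ each set $\mathcal T=LGO_N(\cdot)$ is first replaced by its closure, the set of all $X_0a_1X_1\dots a_nX_n$ for which there is $Y_0a_1Y_1\dots a_nY_n\in\mathcal T$ related to it as in the definition of that preorder. -/

import Mathlib

universe u v w

/-! ### Labelled transition systems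

A process is a state `p : P` of a labelled transition system given by its transition relation
`tr : P → Act → P → Prop`, where `tr p a p'` means `p --a--> p'`. -/

section LTS

variable {Act : Type u} {P : Type v}

/-- `Steps tr p α q`: the process `p` can perform the sequence of actions `α` and become `q`. -/
inductive Steps (tr : P → Act → P → Prop) : P → List Act → P → Prop
  | nil (p : P) : Steps tr p [] p
  | cons {p p' q : P} {a : Act} {α : List Act} :
      tr p a p' → Steps tr p' α q → Steps tr p (a :: α) q

/-- `p` is image-finite: no state reachable from `p` has infinitely many successors under one
and the same action. -/
def ImageFinite (tr : P → Act → P → Prop) (p : P) : Prop :=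
  ∀ (α : List Act) (p' : P), Steps tr p α p' → ∀ a : Act, {p'' : P | tr p' a p''}.Finite

/-- The initial offer `I(p)`. -/
def initials (tr : P → Act → P → Prop) (p : P) : Set Act :=
  {a | ∃ p', tr p a p'}

/-- The set of traces `T(p)`. -/
def traces (tr : P → Act → P → Prop) (p : P) : Set (List Act) :=
  {α | ∃ p', Steps tr p α p'}

/-- `R` is a (plain) simulation. -/
def IsSimulation (tr : P → Act → P → Prop) (R : P → P → Prop) : Prop :=
  ∀ p q, R p q → ∀ a p', tr p a p' → ∃ q', tr q a q' ∧ R p' q'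

/-- The simulation preorder `p ⊑_S q`. -/
def SimLE (tr : P → Act → P → Prop) (p q : P) : Prop :=
  ∃ R : P → P → Prop, IsSimulation tr R ∧ R p q

theorem SimLE.refl (tr : P → Act → P → Prop) (p : P) : SimLE tr p p :=
  ⟨Eq, by rintro p _ rfl a p' h; exact ⟨p', h, rfl⟩, rfl⟩

theorem SimLE.trans {tr : P → Act → P → Prop} {p q r : P}
    (h₁ : SimLE tr p q) (h₂ : SimLE tr q r) : SimLE tr p r := by
  obtain ⟨R, hR, hpq⟩ := h₁
  obtain ⟨Q, hQ, hqr⟩ := h₂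
  refine ⟨fun x z => ∃ y, R x y ∧ Q y z, ?_, q, hpq, hqr⟩
  rintro x z ⟨y, hxy, hyz⟩ a x' hx
  obtain ⟨y', hy', hR'⟩ := hR x y hxy a x' hx
  obtain ⟨z', hz', hQ'⟩ := hQ y z hyz a y' hy'
  exact ⟨z', hz', y', hR', hQ'⟩

/-- Simulation equivalence. -/
def simSetoid (tr : P → Act → P → Prop) : Setoid P where
  r p q := SimLE tr p q ∧ SimLE tr q p
  iseqv :=
    { refl := fun p => ⟨SimLE.refl tr p, SimLE.refl tr p⟩
      symm := fun h => ⟨h.2, h.1⟩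
      trans := fun h k => ⟨h.1.trans k.1, k.2.trans h.2⟩ }

/-- The order on simulation classes: `[[p]]_S ≤_S [[q]]_S` iff `p ⊑_S q`. -/
def simClassLE (tr : P → Act → P → Prop) (x y : Quotient (simSetoid tr)) : Prop :=
  Quotient.liftOn₂ x y (SimLE tr) (fun _ _ _ _ h k => propext
    ⟨fun e => (h.2.trans e).trans k.1, fun e => (h.1.trans e).trans k.2⟩)

end LTS

/-! ### Branching general observations

Finite trees with arcs labelled by actions, nodes labelled by local observations, and, at every
node, a finite *set* of pairs (arc, subtree). -/

section BGO

variable {Act : Type u} {L : Type v}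

/-- Presentations of finite labelled trees, with an indexed family of children at every node. -/
inductive PreBGO (Act : Type u) (L : Type v) : Type (max u v)
  | node (l : L) (n : ℕ) (a : Fin n → Act) (t : Fin n → PreBGO Act L) : PreBGO Act L

/-- Two presentations denote the same tree when their roots carry the same label and their
families of children have the same range, recursively. -/
def PreBGO.Equiv : PreBGO Act L → PreBGO Act L → Prop
  | .node l n a t, .node l' n' a' t' =>
      l = l' ∧
      (∀ i : Fin n, ∃ j : Fin n', a i = a' j ∧ PreBGO.Equiv (t i) (t' j)) ∧
      (∀ j : Fin n', ∃ i : Fin n, a i = a' j ∧ PreBGO.Equiv (t i) (t' j))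

theorem PreBGO.Equiv.refl (x : PreBGO Act L) : PreBGO.Equiv x x := by
  induction x with
  | node l n a t ih => exact ⟨rfl, fun i => ⟨i, rfl, ih i⟩, fun i => ⟨i, rfl, ih i⟩⟩

theorem PreBGO.Equiv.symm {x y : PreBGO Act L} (h : PreBGO.Equiv x y) : PreBGO.Equiv y x := by
  induction x generalizing y with
  | node l n a t ih =>
    cases y with
    | node l' n' a' t' =>
      obtain ⟨h₀, h₁, h₂⟩ := h
      refine ⟨h₀.symm, fun j => ?_, fun i => ?_⟩
      · obtain ⟨i, e, k⟩ := h₂ j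
        exact ⟨i, e.symm, ih i k⟩
      · obtain ⟨j, e, k⟩ := h₁ i
        exact ⟨j, e.symm, ih i k⟩

theorem PreBGO.Equiv.trans {x y z : PreBGO Act L} (h : PreBGO.Equiv x y)
    (k : PreBGO.Equiv y z) : PreBGO.Equiv x z := by
  induction x generalizing y z with
  | node l n a t ih =>
    cases y with
    | node l' n' a' t' =>
      cases z with
      | node l'' n'' a'' t'' =>
        obtain ⟨h₀, h₁, h₂⟩ := h
        obtain ⟨k₀, k₁, k₂⟩ := k
        refine ⟨h₀.trans k₀, fun i => ?_, fun m => ?_⟩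
        · obtain ⟨j, e, g⟩ := h₁ i
          obtain ⟨m, e', g'⟩ := k₁ j
          exact ⟨m, e.trans e', ih i g g'⟩
        · obtain ⟨j, e', g'⟩ := k₂ m
          obtain ⟨i, e, g⟩ := h₂ j
          exact ⟨i, e.trans e', ih i g g'⟩

instance PreBGO.setoid (Act : Type u) (L : Type v) : Setoid (PreBGO Act L) where
  r := PreBGO.Equiv
  iseqv := ⟨PreBGO.Equiv.refl, PreBGO.Equiv.symm, PreBGO.Equiv.trans⟩

/-- The branching general observations over the local observations `L`. -/
def BGO (Act : Type u) (L : Type v) : Type (max u v) := Quotient (PreBGO.setoid Act L)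

/-- The observation denoted by a presentation. -/
def BGO.mk (x : PreBGO Act L) : BGO Act L := Quotient.mk _ x

/-- A presentation of an observation. -/
noncomputable def BGO.out (o : BGO Act L) : PreBGO Act L := Quotient.out (s := PreBGO.setoid Act L) o

theorem BGO.mk_out (o : BGO Act L) : BGO.mk o.out = o :=
  Quotient.out_eq (s := PreBGO.setoid Act L) o

theorem BGO.mk_eq_mk {x y : PreBGO Act L} : BGO.mk x = BGO.mk y ↔ PreBGO.Equiv x y :=
  ⟨fun h => Quotient.exact (s := PreBGO.setoid Act L) h,
    fun h => Quotient.sound (s := PreBGO.setoid Act L) h⟩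

/-- The observation `⟨l, S⟩` with root `l` and finite set of children `S`. -/
noncomputable def BGO.node (l : L) (S : Finset (Act × BGO Act L)) : BGO Act L :=
  BGO.mk (PreBGO.node l S.card (fun i => (S.equivFin.symm i).1.1)
    (fun i => (S.equivFin.symm i).1.2.out))

/-- An observation is determined by its root label and its set of children, and conversely. -/
theorem BGO.node_inj {l l' : L} {S S' : Finset (Act × BGO Act L)} :
    BGO.node l S = BGO.node l' S' ↔ l = l' ∧ S = S' := by
  constructor
  · intro h
    obtain ⟨h₀, h₁, h₂⟩ := BGO.mk_eq_mk.1 h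
    refine ⟨h₀, Finset.Subset.antisymm (fun c hc => ?_) (fun c hc => ?_)⟩
    · obtain ⟨j, e, k⟩ := h₁ (S.equivFin ⟨c, hc⟩)
      have k' := BGO.mk_eq_mk.2 k
      simp only [Equiv.symm_apply_apply, BGO.mk_out] at e k'
      have : c = (S'.equivFin.symm j).1 := Prod.ext e k'
      rw [this]
      exact (S'.equivFin.symm j).2
    · obtain ⟨i, e, k⟩ := h₂ (S'.equivFin ⟨c, hc⟩)
      have k' := BGO.mk_eq_mk.2 k
      simp only [Equiv.symm_apply_apply, BGO.mk_out] at e k'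
      have : (S.equivFin.symm i).1 = c := Prod.ext e k'
      rw [← this]
      exact (S.equivFin.symm i).2
  · rintro ⟨rfl, rfl⟩
    rfl

/-- Every observation is built from local observations by finitely many applications of
`BGO.node`. -/
theorem BGO.induction {motive : BGO Act L → Prop}
    (h : ∀ (l : L) (S : Finset (Act × BGO Act L)), (∀ c ∈ S, motive c.2) → motive (BGO.node l S))
    (o : BGO Act L) : motive o := by
  classical
  suffices H : ∀ x : PreBGO Act L, motive (BGO.mk x) by
    have := H o.out
    rwa [BGO.mk_out] at this
  intro x
  induction x with
  | node l n a t ih =>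
    let f : Fin n → Act × BGO Act L := fun i => (a i, BGO.mk (t i))
    have key : BGO.mk (PreBGO.node l n a t) = BGO.node l (Finset.univ.image f) := by
      refine BGO.mk_eq_mk.2 ⟨rfl, fun i => ?_, fun j => ?_⟩
      · refine ⟨(Finset.univ.image f).equivFin ⟨f i, by simp⟩, ?_, BGO.mk_eq_mk.1 ?_⟩
        · simp [f]
        · simp [f, BGO.mk_out]
      · obtain ⟨i, -, hi⟩ := Finset.mem_image.1 ((Finset.univ.image f).equivFin.symm j).2
        refine ⟨i, congrArg Prod.fst hi, BGO.mk_eq_mk.1 ?_⟩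
        rw [BGO.mk_out]
        exact congrArg Prod.snd hi
    rw [key]
    refine h _ _ fun c hc => ?_
    obtain ⟨i, -, rfl⟩ := Finset.mem_image.1 hc
    exact ih i

/-- Deterministic observations: at every node, different children have different arcs. -/
inductive BGO.Deterministic : BGO Act L → Prop
  | node (l : L) (S : Finset (Act × BGO Act L)) :
      (∀ c ∈ S, ∀ d ∈ S, c.1 = d.1 → c = d) → (∀ c ∈ S, BGO.Deterministic c.2) →
      BGO.Deterministic (BGO.node l S)

variable {P : Type w}

/-- `IsBGO tr obs p o`: `o` is a branching general observation of `p` for the local observation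
function `obs`, i.e. `o = ⟨obs p, S⟩` with `S` a finite set of pairs `(a, o')` such that `o'` is
an observation of some `p'` with `p --a--> p'`. -/
inductive IsBGO (tr : P → Act → P → Prop) (obs : P → L) : P → BGO Act L → Prop
  | node (p : P) (S : Finset (Act × BGO Act L)) (p' : Act × BGO Act L → P) :
      (∀ c ∈ S, tr p c.1 (p' c)) → (∀ c ∈ S, IsBGO tr obs (p' c) c.2) →
      IsBGO tr obs p (BGO.node (obs p) S)

/-- The set `BGO_N(p)`. -/
def bgoSet (tr : P → Act → P → Prop) (obs : P → L) (p : P) : Set (BGO Act L) :=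
  {o | IsBGO tr obs p o}

/-- The set `dBGO_N(p)`. -/
def dbgoSet (tr : P → Act → P → Prop) (obs : P → L) (p : P) : Set (BGO Act L) :=
  bgoSet tr obs p ∩ {o | o.Deterministic}

/-! ### Linear general observations -/

/-- Linear general observations `X₀ a₁ X₁ … aₙ Xₙ`. -/
inductive LGO (Act : Type u) (L : Type v) : Type (max u v)
  | final (l : L) : LGO Act L
  | step (l : L) (a : Act) (o : LGO Act L) : LGO Act L

/-- `IsLGO tr obs p o`: `o` is a linear general observation of `p`. -/
inductive IsLGO (tr : P → Act → P → Prop) (obs : P → L) : P → LGO Act L → Prop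
  | final (p : P) : IsLGO tr obs p (LGO.final (obs p))
  | step {p p' : P} {a : Act} {o : LGO Act L} :
      tr p a p' → IsLGO tr obs p' o → IsLGO tr obs p (LGO.step (obs p) a o)

/-- The set `LGO_N(p)`. -/
def lgoSet (tr : P → Act → P → Prop) (obs : P → L) (p : P) : Set (LGO Act L) :=
  {o | IsLGO tr obs p o}

/-- Linear observations as degenerate branching observations. -/
noncomputable def LGO.toBGO : LGO Act L → BGO Act L
  | .final l => BGO.node l ∅
  | .step l a o => BGO.node l {(a, o.toBGO)}

/-- `LGO_N(p)` consists of the branching observations of `p` that are linear. -/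
theorem isLGO_iff_toBGO (tr : P → Act → P → Prop) (obs : P → L) (p : P) (o : LGO Act L) :
    IsLGO tr obs p o ↔ IsBGO tr obs p o.toBGO := by
  constructor
  · intro h
    induction h with
    | final p => exact IsBGO.node p ∅ (fun _ => p) (by simp) (by simp)
    | @step p p' a o h _ ih =>
      exact IsBGO.node p {(a, o.toBGO)} (fun _ => p') (by simpa using h) (by simpa using ih)
  · intro h
    induction o generalizing p with
    | final l =>
      generalize hx : LGO.toBGO (LGO.final (Act := Act) l) = x at h
      cases h with
      | node _ S p' h₁ h₂ =>
        obtain ⟨rfl, -⟩ := BGO.node_inj.1 hx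
        exact IsLGO.final p
    | step l a o ih =>
      generalize hx : LGO.toBGO (LGO.step l a o) = x at h
      cases h with
      | node _ S p' h₁ h₂ =>
        obtain ⟨rfl, rfl⟩ := BGO.node_inj.1 hx
        exact IsLGO.step (h₁ _ (Finset.mem_singleton_self _))
          (ih _ (h₂ _ (Finset.mem_singleton_self _)))

/-- `X₀a₁X₁…aₙXₙ` and `Y₀a₁Y₁…aₙYₙ` have the same actions and `r Xᵢ Yᵢ` for all `i ∈ 0..n`. -/
inductive LGO.Along (r : L → L → Prop) : LGO Act L → LGO Act L → Prop
  | final {l l' : L} : r l l' → LGO.Along r (.final l) (.final l')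
  | step {l l' : L} (a : Act) {o o' : LGO Act L} :
      r l l' → LGO.Along r o o' → LGO.Along r (.step l a o) (.step l' a o')

/-- `X₀a₁X₁…aₙXₙ` and `Y₀a₁Y₁…aₙYₙ` have the same actions and `r Xₙ Yₙ`. -/
inductive LGO.AtEnd (r : L → L → Prop) : LGO Act L → LGO Act L → Prop
  | final {l l' : L} : r l l' → LGO.AtEnd r (.final l) (.final l')
  | step (l l' : L) (a : Act) {o o' : LGO Act L} :
      LGO.AtEnd r o o' → LGO.AtEnd r (.step l a o) (.step l' a o')

/-- Every element of `A` is related to some element of `B`. -/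
def Dominated {X : Type w} (R : X → X → Prop) (A B : Set X) : Prop :=
  ∀ x ∈ A, ∃ y ∈ B, R x y

/-- The closure of `B`: all elements that are related to some element of `B`. -/
def closureBy {X : Type w} (R : X → X → Prop) (B : Set X) : Set X :=
  {x | ∃ y ∈ B, R x y}

end BGO

/-! ### Constraints, kinds of semantics and the observational preorders -/

/-- The constraints: universal, complete, initial offer, trace, simulation. -/
inductive Constraint
  | U | C | I | T | S

/-- The kinds of semantics at each layer. -/
inductive SemKind
  /-- `NS` -/
  | simulation
  /-- `≤_N^l` -/
  | readyTrace
  /-- `≤_N^{l⊇}` -/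
  | failureTrace
  /-- `≤_N^{lf}` -/
  | readiness
  /-- `≤_N^{lf⊇}` -/
  | failures
  /-- `≤_N^{l⊆}` -/
  | partialOfferTrace
  /-- `≤_N^{lf⊆}` -/
  | partialOffer
  /-- `D_N` -/
  | deterministic

section Observational

variable {Act : Type u} {P : Type v} {L : Type w}

/-- The observational preorder of kind `Y` for the local observation function `obs`, where `sup`
and `sub` are the relations written `⊇` and `⊆` on local observations. -/
def obsLEWith (tr : P → Act → P → Prop) (obs : P → L) (sup sub : L → L → Prop)
    (Y : SemKind) (p q : P) : Prop :=
  match Y with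
  | .simulation => bgoSet tr obs p ⊆ bgoSet tr obs q
  | .readyTrace => lgoSet tr obs p ⊆ lgoSet tr obs q
  | .failureTrace => Dominated (LGO.Along sup) (lgoSet tr obs p) (lgoSet tr obs q)
  | .readiness => Dominated (LGO.AtEnd Eq) (lgoSet tr obs p) (lgoSet tr obs q)
  | .failures => Dominated (LGO.AtEnd sup) (lgoSet tr obs p) (lgoSet tr obs q)
  | .partialOfferTrace => Dominated (LGO.Along sub) (lgoSet tr obs p) (lgoSet tr obs q)
  | .partialOffer => Dominated (LGO.AtEnd sub) (lgoSet tr obs p) (lgoSet tr obs q)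
  | .deterministic => dbgoSet tr obs p ⊆ dbgoSet tr obs q

/-- The presentation of the same preorders as inclusions between sets of observations, closed
under the relevant relation in the linear cases. -/
def obsInclWith (tr : P → Act → P → Prop) (obs : P → L) (sup sub : L → L → Prop)
    (Y : SemKind) (p q : P) : Prop :=
  match Y with
  | .simulation => bgoSet tr obs p ⊆ bgoSet tr obs q
  | .readyTrace => lgoSet tr obs p ⊆ lgoSet tr obs q
  | .failureTrace =>
      closureBy (LGO.Along sup) (lgoSet tr obs p) ⊆ closureBy (LGO.Along sup) (lgoSet tr obs q)
  | .readiness =>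
      closureBy (LGO.AtEnd Eq) (lgoSet tr obs p) ⊆ closureBy (LGO.AtEnd Eq) (lgoSet tr obs q)
  | .failures =>
      closureBy (LGO.AtEnd sup) (lgoSet tr obs p) ⊆ closureBy (LGO.AtEnd sup) (lgoSet tr obs q)
  | .partialOfferTrace =>
      closureBy (LGO.Along sub) (lgoSet tr obs p) ⊆ closureBy (LGO.Along sub) (lgoSet tr obs q)
  | .partialOffer =>
      closureBy (LGO.AtEnd sub) (lgoSet tr obs p) ⊆ closureBy (LGO.AtEnd sub) (lgoSet tr obs q)
  | .deterministic => dbgoSet tr obs p ⊆ dbgoSet tr obs q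

/-- The local observation for `C`: `true` iff the process is terminated. -/
noncomputable def terminated (tr : P → Act → P → Prop) (p : P) : Bool :=
  open Classical in decide (initials tr p = ∅)

/-- The relation `⊆` on local observations for `C`: if the second state is terminated then so is
the first one, that is, a state that can act is matched only by a state that can act. -/
def boolSub (b b' : Bool) : Prop := b' = true → b = true

/-- The observational preorder of kind `Y` at the layer `N`. The relation `⊇` is equality for
`U` and `C`, inclusion for `I` and `T`, and the simulation order on classes for `S`. -/
noncomputable def ObsLE (tr : P → Act → P → Prop) (N : Constraint) (Y : SemKind) (p q : P) :
    Prop :=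
  match N with
  | .U => obsLEWith tr (fun _ => ()) Eq Eq Y p q
  | .C => obsLEWith tr (terminated tr) Eq boolSub Y p q
  | .I => obsLEWith tr (initials tr) (fun X Z => Z ⊆ X) (fun X Z => X ⊆ Z) Y p q
  | .T => obsLEWith tr (traces tr) (fun X Z => Z ⊆ X) (fun X Z => X ⊆ Z) Y p q
  | .S => obsLEWith tr (Quotient.mk (simSetoid tr)) (fun X Z => simClassLE tr Z X)
      (fun X Z => simClassLE tr X Z) Y p q

/-- The observational preorder presented as inclusion of (closed) sets of observations. -/
noncomputable def ObsIncl (tr : P → Act → P → Prop) (N : Constraint) (Y : SemKind) (p q : P) :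
    Prop :=
  match N with
  | .U => obsInclWith tr (fun _ => ()) Eq Eq Y p q
  | .C => obsInclWith tr (terminated tr) Eq boolSub Y p q
  | .I => obsInclWith tr (initials tr) (fun X Z => Z ⊆ X) (fun X Z => X ⊆ Z) Y p q
  | .T => obsInclWith tr (traces tr) (fun X Z => Z ⊆ X) (fun X Z => X ⊆ Z) Y p q
  | .S => obsInclWith tr (Quotient.mk (simSetoid tr)) (fun X Z => simClassLE tr Z X)
      (fun X Z => simClassLE tr X Z) Y p q

end Observational

/-! ### Hennessy-Milner logic and its sublogics -/

section Logic

variable {Act : Type u} {P : Type v}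

/-- Hennessy-Milner formulas, with conjunctions over arbitrary index types. -/
inductive HML (Act : Type u) : Type (u + 1)
  | conj {ι : Type u} (φ : ι → HML Act) : HML Act
  | dia (a : Act) (φ : HML Act) : HML Act
  | neg (φ : HML Act) : HML Act

/-- The satisfaction relation. -/
def HML.Sat (tr : P → Act → P → Prop) : HML Act → P → Prop
  | .conj φ, p => ∀ i, HML.Sat tr (φ i) p
  | .dia a φ, p => ∃ q, tr p a q ∧ HML.Sat tr φ q
  | .neg φ, p => ¬ HML.Sat tr φ p

/-- `⊤`, the empty conjunction. -/
def HML.top : HML Act := .conj (ι := PEmpty) (fun i => i.elim)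

/-- Binary conjunction. -/
def HML.and (φ ψ : HML Act) : HML Act :=
  .conj (ι := ULift Bool) (fun i => if i.down then φ else ψ)

/-- `0 = ⋀_{a ∈ Act} ¬ a⊤`. -/
def HML.zero : HML Act := .conj (fun a : Act => .neg (.dia a .top))

/-- `¬ 0`. -/
def HML.nonzero : HML Act := .neg .zero

/-- The finitary formulas, all of whose conjunctions are finite. -/
inductive HML.Finitary : HML Act → Prop
  | conj {ι : Type u} (φ : ι → HML Act) :
      Finite ι → (∀ i, HML.Finitary (φ i)) → HML.Finitary (.conj φ)
  | dia (a : Act) (φ : HML Act) : HML.Finitary φ → HML.Finitary (.dia a φ)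
  | neg (φ : HML Act) : HML.Finitary φ → HML.Finitary (.neg φ)

/-- The preorder induced by a set of formulas. -/
def LogicLE (tr : P → Act → P → Prop) (K : Set (HML Act)) (p q : P) : Prop :=
  ∀ φ ∈ K, HML.Sat tr φ p → HML.Sat tr φ q

/-- The symmetric closure of a set of formulas. -/
inductive SymClosure (K : Set (HML Act)) : HML Act → Prop
  | pos (σ : HML Act) : σ ∈ K → SymClosure K σ
  | neg (σ : HML Act) : σ ∈ K → SymClosure K (.neg σ)
  | conj {ι : Type u} (σ : ι → HML Act) : (∀ i, SymClosure K (σ i)) → SymClosure K (.conj σ)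

/-- The negative closure of a set of formulas. -/
inductive NegClosure (K : Set (HML Act)) : HML Act → Prop
  | neg (σ : HML Act) : σ ∈ K → NegClosure K (.neg σ)
  | conj {ι : Type u} (σ : ι → HML Act) : (∀ i, NegClosure K (σ i)) → NegClosure K (.conj σ)

/-- The positive closure of a set of formulas. -/
inductive PosClosure (K : Set (HML Act)) : HML Act → Prop
  | pos (σ : HML Act) : σ ∈ K → PosClosure K σ
  | conj {ι : Type u} (σ : ι → HML Act) : (∀ i, PosClosure K (σ i)) → PosClosure K (.conj σ)

/-- The formulas for the `N`-constrained simulation, from a set `K` of formulas for `N`. -/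
inductive SimLogic (K : Set (HML Act)) : HML Act → Prop
  | pos (σ : HML Act) : σ ∈ K → SimLogic K σ
  | neg (σ : HML Act) : σ ∈ K → SimLogic K (.neg σ)
  | conj {ι : Type u} (φ : ι → HML Act) : (∀ i, SimLogic K (φ i)) → SimLogic K (.conj φ)
  | dia (a : Act) (φ : HML Act) : SimLogic K φ → SimLogic K (.dia a φ)

/-- Linear formulas with local formulas from `Q` all along the computation. -/
inductive AlongLogic (Q : HML Act → Prop) : HML Act → Prop
  | top : AlongLogic Q .top
  | and (σ φ : HML Act) : Q σ → AlongLogic Q φ → AlongLogic Q (.and σ φ)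
  | dia (a : Act) (φ : HML Act) : AlongLogic Q φ → AlongLogic Q (.dia a φ)

/-- Linear formulas with a local formula from `Q` at the end of the computation. -/
inductive AtEndLogic (Q : HML Act → Prop) : HML Act → Prop
  | top : AtEndLogic Q .top
  | loc (σ : HML Act) : Q σ → AtEndLogic Q σ
  | dia (a : Act) (φ : HML Act) : AtEndLogic Q φ → AtEndLogic Q (.dia a φ)

/-- Deterministic branching formulas with local formulas from `Q`. -/
inductive DetLogic (Q : HML Act → Prop) : HML Act → Prop
  | top : DetLogic Q .top
  | and (σ φ : HML Act) : Q σ → DetLogic Q φ → DetLogic Q (.and σ φ)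
  | branch (X : Set Act) (φ : X → HML Act) :
      (∀ a, DetLogic Q (φ a)) → DetLogic Q (.conj (fun a : X => .dia a.1 (φ a)))

/-- Trace formulas. -/
inductive TraceLogic : HML Act → Prop
  | top : TraceLogic .top
  | dia (a : Act) (φ : HML Act) : TraceLogic φ → TraceLogic (.dia a φ)

/-- The logics `L'_N` of the constraints. -/
def constraintLogic : Constraint → Set (HML Act)
  | .U => {HML.top}
  | .C => {HML.top, HML.nonzero}
  | .I => {HML.top, HML.nonzero} ∪ {φ | ∃ a, φ = HML.dia a HML.top}
  | .T => {φ | TraceLogic φ}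
  | .S => {φ | SimLogic {HML.top} φ}

/-- The unified logics `L'_{Y_N}`. -/
def unifiedLogic (N : Constraint) : SemKind → Set (HML Act)
  | .simulation => {φ | SimLogic (constraintLogic N) φ}
  | .readyTrace => {φ | AlongLogic (SymClosure (constraintLogic N)) φ}
  | .failureTrace => {φ | AlongLogic (NegClosure (constraintLogic N)) φ}
  | .readiness => {φ | AtEndLogic (SymClosure (constraintLogic N)) φ}
  | .failures => {φ | AtEndLogic (NegClosure (constraintLogic N)) φ}
  | .partialOfferTrace => {φ | AlongLogic (PosClosure (constraintLogic N)) φ}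
  | .partialOffer => {φ | AtEndLogic (PosClosure (constraintLogic N)) φ}
  | .deterministic => {φ | DetLogic (SymClosure (constraintLogic N)) φ}

/-- The finitary fragments `L^f_{Y_N} = L'_{Y_N} ∩ L^f_HM`. -/
def finitaryLogic (N : Constraint) (Y : SemKind) : Set (HML Act) :=
  unifiedLogic N Y ∩ {φ | φ.Finitary}

end Logic

/-! Since `q` is image-finite, at every step only finitely many states have to be excluded, so every
observation of `p` is enforced by a single formula true at `p`: one conjunct per excluded state,
put together along the observation. Conversely a formula true at `p` is forced on `q` by a single
observation of `p` in the linear cases. For simulations, inclusion of the sets of observations is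
itself a simulation, because finitely many observations of a state can be merged into one. A
deterministic observation has finitely many arcs, and forces an infinite conjunction only on the
prefixes with actions in a given finite set; image-finiteness recovers the formula from all these
restrictions. For the constraint `C`, an observation that ends in a state with a transition is
extended by one step, which turns the one-sided matching of terminated states into equality. -/

section Formulas

variable {Act : Type u} {P : Type v} {tr : P → Act → P → Prop}

theorem ImageFinite.of_step {p p' : P} {a : Act} (hp : ImageFinite tr p) (h : tr p a p') :
    ImageFinite tr p' :=
  fun α _ hs b => hp (a :: α) _ (Steps.cons h hs) b

theorem ImageFinite.finite_succ {p : P} (hp : ImageFinite tr p) (a : Act) :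
    {p' | tr p a p'}.Finite :=
  hp [] p (Steps.nil p) a

/-- The `a`-successors of a set of states. -/
def successors (tr : P → Act → P → Prop) (Q : Set P) (a : Act) : Set P :=
  {q' | ∃ q ∈ Q, tr q a q'}

/-- Finite sets of image-finite states: the sets of states from which a single formula is asked
to single out those with a given property. They are closed under `successors`. -/
structure ImageFiniteSet (tr : P → Act → P → Prop) (Q : Set P) : Prop where
  finite : Q.Finite
  imageFinite : ∀ q ∈ Q, ImageFinite tr q

theorem ImageFinite.singleton {q : P} (hq : ImageFinite tr q) : ImageFiniteSet tr {q} :=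
  ⟨Set.finite_singleton q, by rintro _ rfl; exact hq⟩

theorem ImageFiniteSet.successors {Q : Set P} (hQ : ImageFiniteSet tr Q) (a : Act) :
    ImageFiniteSet tr (successors tr Q a) where
  finite := (hQ.finite.biUnion fun q hq => (hQ.imageFinite q hq).finite_succ a).subset
    fun _ ⟨_, hq, h⟩ => Set.mem_biUnion hq h
  imageFinite := by
    rintro q' ⟨q, hq, h⟩
    exact (hQ.imageFinite q hq).of_step h

theorem HML.sat_top (p : P) : HML.top.Sat tr p := fun i => i.elim

theorem HML.sat_and {φ ψ : HML Act} {p : P} :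
    (φ.and ψ).Sat tr p ↔ φ.Sat tr p ∧ ψ.Sat tr p := by
  simp [HML.and, HML.Sat, ULift.forall, and_comm]

theorem HML.sat_nonzero {p : P} : HML.nonzero.Sat tr p ↔ ∃ a p', tr p a p' := by
  simp only [HML.nonzero, HML.zero, HML.Sat, HML.sat_top, and_true, not_forall, not_not]

/-- Sets of formulas closed under finite conjunctions. -/
def ConjClosed (H : Set (HML Act)) : Prop :=
  ∀ ⦃ι : Type u⦄ [Finite ι] (φ : ι → HML Act), (∀ i, φ i ∈ H) → HML.conj φ ∈ H

theorem ConjClosed.top_mem {H : Set (HML Act)} (hH : ConjClosed H) : HML.top ∈ H :=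
  hH _ fun i => i.elim

theorem ConjClosed.and_mem {H : Set (HML Act)} (hH : ConjClosed H) {φ ψ : HML Act}
    (hφ : φ ∈ H) (hψ : ψ ∈ H) : φ.and ψ ∈ H :=
  hH _ fun i => by by_cases h : i.down <;> simpa only [h]

theorem ConjClosed.inter {G H : Set (HML Act)} (hG : ConjClosed G) (hH : ConjClosed H) :
    ConjClosed (G ∩ H) :=
  fun _ _ φ h => ⟨hG φ fun i => (h i).1, hH φ fun i => (h i).2⟩

theorem ConjClosed.posClosure (K : Set (HML Act)) : ConjClosed {σ | PosClosure K σ} :=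
  fun _ _ φ h => .conj φ h

theorem ConjClosed.negClosure (K : Set (HML Act)) : ConjClosed {σ | NegClosure K σ} :=
  fun _ _ φ h => .conj φ h

theorem ConjClosed.symClosure (K : Set (HML Act)) : ConjClosed {σ | SymClosure K σ} :=
  fun _ _ φ h => .conj φ h

theorem ConjClosed.simLogic (K : Set (HML Act)) : ConjClosed {φ | SimLogic K φ} :=
  fun _ _ φ h => .conj φ h

/-- Sets of formulas closed under finite conjunctions, prefixes and negations. Both the set of
all formulas and the set of finitary ones qualify, so that a logic and its finitary fragment can
be treated together. -/
structure FinitelyClosed (F : Set (HML Act)) : Prop where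
  conj : ConjClosed F
  dia : ∀ (a : Act), ∀ φ ∈ F, HML.dia a φ ∈ F
  neg : ∀ φ ∈ F, HML.neg φ ∈ F

theorem FinitelyClosed.univ : FinitelyClosed (Set.univ : Set (HML Act)) :=
  ⟨fun _ _ _ _ => trivial, fun _ _ _ => trivial, fun _ _ => trivial⟩

theorem FinitelyClosed.finitary : FinitelyClosed {φ : HML Act | φ.Finitary} :=
  ⟨fun _ _ φ h => .conj φ inferInstance h, fun a φ h => .dia a φ h, fun φ h => .neg φ h⟩

theorem HML.finitary_nonzero [Finite Act] : (HML.nonzero : HML Act).Finitary :=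
  .neg _ (.conj _ inferInstance fun a =>
    .neg _ (.dia a _ FinitelyClosed.finitary.conj.top_mem))

theorem LogicLE.mono {H K : Set (HML Act)} (hHK : H ⊆ K) {p q : P} (h : LogicLE tr K p q) :
    LogicLE tr H p q :=
  fun φ hφ => h φ (hHK hφ)

/-- Some formula of `H` that is true at `p` guarantees the property `C` for the states of `Q`. -/
def Enforces (tr : P → Act → P → Prop) (H : Set (HML Act)) (p : P) (Q : Set P)
    (C : P → Prop) : Prop :=
  ∃ φ ∈ H, φ.Sat tr p ∧ ∀ q ∈ Q, φ.Sat tr q → C q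

variable {H H₁ H₂ : Set (HML Act)} {p p' : P} {Q : Set P} {a : Act} {C C₁ C₂ : P → Prop}

theorem LogicLE.of_enforces {q : P} (h : LogicLE tr H p q) (hC : Enforces tr H p {q} C) : C q := by
  obtain ⟨φ, hφ, hp, hq⟩ := hC
  exact hq q rfl (h φ hφ hp)

theorem Enforces.imp (h : Enforces tr H p Q C₁) (hC : ∀ q, C₁ q → C₂ q) :
    Enforces tr H p Q C₂ := by
  obtain ⟨φ, hφ, hp, hq⟩ := h
  exact ⟨φ, hφ, hp, fun q hqQ hs => hC q (hq q hqQ hs)⟩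

theorem Enforces.and (h₁ : Enforces tr H₁ p Q C₁) (h₂ : Enforces tr H₂ p Q C₂)
    (hand : ∀ φ ∈ H₁, ∀ ψ ∈ H₂, φ.and ψ ∈ H) : Enforces tr H p Q fun q => C₁ q ∧ C₂ q := by
  obtain ⟨φ, hφ, hφp, hφQ⟩ := h₁
  obtain ⟨ψ, hψ, hψp, hψQ⟩ := h₂
  refine ⟨φ.and ψ, hand φ hφ ψ hψ, HML.sat_and.2 ⟨hφp, hψp⟩, fun q hq hs => ?_⟩
  exact ⟨hφQ q hq (HML.sat_and.1 hs).1, hψQ q hq (HML.sat_and.1 hs).2⟩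

theorem Enforces.dia (h : Enforces tr H₁ p' (successors tr Q a) C) (hp : tr p a p')
    (hdia : ∀ φ ∈ H₁, HML.dia a φ ∈ H) :
    Enforces tr H p Q fun q => ∃ q', tr q a q' ∧ C q' := by
  obtain ⟨φ, hφ, hφp, hφQ⟩ := h
  refine ⟨.dia a φ, hdia φ hφ, ⟨p', hp, hφp⟩, ?_⟩
  rintro q hq ⟨q', hqq', hs⟩
  exact ⟨q', hqq', hφQ q' ⟨q, hq, hqq'⟩ hs⟩

theorem Enforces.branch {X : Set Act} {C : X → P → Prop}
    (h : ∀ a : X, ∃ p', tr p a p' ∧ Enforces tr H₁ p' (successors tr Q a) (C a))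
    (hbranch : ∀ φ : X → HML Act, (∀ a, φ a ∈ H₁) → HML.conj (fun a : X => .dia a.1 (φ a)) ∈ H) :
    Enforces tr H p Q fun q => ∀ a : X, ∃ q', tr q a q' ∧ C a q' := by
  choose p' hp φ hφ hφp hφQ using h
  refine ⟨_, hbranch φ hφ, fun a => ⟨p' a, hp a, hφp a⟩, fun q hq hs a => ?_⟩
  obtain ⟨q', hqq', hs⟩ := hs a
  exact ⟨q', hqq', hφQ a q' ⟨q, hq, hqq'⟩ hs⟩

theorem ConjClosed.enforces_of_logicLE (hH : ConjClosed H) (hQ : Q.Finite)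
    (hC : ∀ q ∈ Q, LogicLE tr H p q → C q) : Enforces tr H p Q C := by
  induction Q, hQ using Set.Finite.induction_on with
  | empty => exact ⟨.top, hH.top_mem, HML.sat_top p, by simp⟩
  | @insert q Q _ _ ih =>
    obtain ⟨φ, hφ, hφp, hφQ⟩ := ih fun r hr => hC r (Set.mem_insert_of_mem q hr)
    by_cases hq : LogicLE tr H p q
    · refine ⟨φ, hφ, hφp, ?_⟩
      rintro r (rfl | hr) hs
      · exact hC r (Set.mem_insert r Q) hq
      · exact hφQ r hr hs
    · simp only [LogicLE, not_forall] at hq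
      obtain ⟨ψ, hψ, hψp, hψq⟩ := hq
      refine ⟨ψ.and φ, hH.and_mem hψ hφ, HML.sat_and.2 ⟨hψp, hφp⟩, ?_⟩
      rintro r (rfl | hr) hs
      · exact absurd (HML.sat_and.1 hs).1 hψq
      · exact hφQ r hr (HML.sat_and.1 hs).2

end Formulas

/-! ### Local observations -/

section Local

variable {Act : Type u} {P : Type v} {L : Type w} {tr : P → Act → P → Prop} {obs : P → L}
  {r : L → L → Prop} {K F : Set (HML Act)} {D : Set P}

/-- The formulas of `K` are preserved by the relation `r` on local observations. -/
def LocallySound (tr : P → Act → P → Prop) (obs : P → L) (r : L → L → Prop)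
    (K : Set (HML Act)) : Prop :=
  ∀ ⦃p q : P⦄, r (obs p) (obs q) → LogicLE tr K p q

/-- On the states in `D`, the formulas of `K` determine the relation `r` between local
observations. -/
def LocallyComplete (tr : P → Act → P → Prop) (D : Set P) (obs : P → L) (r : L → L → Prop)
    (K : Set (HML Act)) : Prop :=
  ∀ ⦃p : P⦄, p ∈ D → ∀ ⦃q : P⦄, q ∈ D → LogicLE tr K p q → r (obs p) (obs q)

theorem LocallySound.posClosure (h : LocallySound tr obs r K) :
    LocallySound tr obs r {σ | PosClosure K σ} := by
  intro p q hpq σ hσ hp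
  induction hσ with
  | pos σ hσ => exact h hpq σ hσ hp
  | conj σ _ ih => exact fun i => ih i (hp i)

theorem LocallySound.negClosure (h : LocallySound tr obs r K) :
    LocallySound tr obs (Function.swap r) {σ | NegClosure K σ} := by
  intro p q hqp σ hσ hp
  induction hσ with
  | neg σ hσ => exact fun hq => hp (h hqp σ hσ hq)
  | conj σ _ ih => exact fun i => ih i (hp i)

theorem LocallySound.symClosure [Std.Refl r] (h : LocallySound tr obs r K) :
    LocallySound tr obs Eq {σ | SymClosure K σ} := by
  intro p q hpq σ hσ hp
  induction hσ with
  | pos σ hσ => exact h (hpq ▸ refl_of r _) σ hσ hp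
  | neg σ hσ => exact fun hq => hp (h (hpq ▸ refl_of r _) σ hσ hq)
  | conj σ _ ih => exact fun i => ih i (hp i)

theorem LocallyComplete.posClosure (h : LocallyComplete tr D obs r (K ∩ F)) :
    LocallyComplete tr D obs r ({σ | PosClosure K σ} ∩ F) :=
  fun _ hp _ hq hpq => h hp hq fun σ hσ => hpq σ ⟨.pos σ hσ.1, hσ.2⟩

theorem LocallyComplete.negClosure (h : LocallyComplete tr D obs r (K ∩ F))
    (hF : FinitelyClosed F) :
    LocallyComplete tr D obs (Function.swap r) ({σ | NegClosure K σ} ∩ F) := by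
  intro p hp q hq hpq
  refine h hq hp fun σ hσ hσq => ?_
  by_contra hσp
  exact hpq (.neg σ) ⟨.neg σ hσ.1, hF.neg σ hσ.2⟩ hσp hσq

theorem LocallyComplete.symClosure [Std.Antisymm r] (h : LocallyComplete tr D obs r (K ∩ F))
    (hF : FinitelyClosed F) : LocallyComplete tr D obs Eq ({σ | SymClosure K σ} ∩ F) := by
  intro p hp q hq hpq
  refine antisymm_of r (h hp hq fun σ hσ => ?_) (h hq hp fun σ hσ hσq => ?_)
  · exact hpq σ ⟨.pos σ hσ.1, hσ.2⟩
  · by_contra hσp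
    exact hpq (.neg σ) ⟨.neg σ hσ.1, hF.neg σ hσ.2⟩ hσp hσq

/-- Sets of states that are closed under transitions and contain all image-finite states: they
serve as domains on which formulas have to determine local observations. -/
structure Admissible (tr : P → Act → P → Prop) (D : Set P) : Prop where
  of_step : ∀ ⦃p p' : P⦄ ⦃a : Act⦄, p ∈ D → tr p a p' → p' ∈ D
  of_imageFinite : ∀ ⦃p : P⦄, ImageFinite tr p → p ∈ D

theorem Admissible.univ (tr : P → Act → P → Prop) : Admissible tr Set.univ :=
  ⟨fun _ _ _ _ _ => trivial, fun _ _ => trivial⟩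

theorem Admissible.imageFinite (tr : P → Act → P → Prop) : Admissible tr {p | ImageFinite tr p} :=
  ⟨fun _ _ _ hp h => ImageFinite.of_step hp h, fun _ => id⟩

theorem LocallyComplete.enforces (h : LocallyComplete tr D obs r K) (hK : ConjClosed K)
    (hD : Admissible tr D) {p : P} (hp : p ∈ D) {Q : Set P} (hQ : ImageFiniteSet tr Q) :
    Enforces tr K p Q fun q => r (obs p) (obs q) :=
  hK.enforces_of_logicLE hQ.finite fun q hq =>
    h hp (hD.of_imageFinite (hQ.imageFinite q hq))

end Local

/-! ### Simulations -/

section Simulations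

variable {Act : Type u} {P : Type v} {tr : P → Act → P → Prop}

theorem isSimulation_logicLE {H : Set (HML Act)} (hconj : ConjClosed H)
    (hdia : ∀ a, ∀ φ ∈ H, HML.dia a φ ∈ H) :
    IsSimulation tr fun p q => ImageFinite tr q ∧ LogicLE tr H p q := by
  rintro p q ⟨hq, hpq⟩ a p' hp'
  have hQ := hq.singleton.successors a
  have key : Enforces tr H p' (successors tr {q} a)
      fun q' => ImageFinite tr q' ∧ LogicLE tr H p' q' :=
    hconj.enforces_of_logicLE hQ.finite fun q' hq' h => ⟨hQ.imageFinite q' hq', h⟩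
  exact hpq.of_enforces (key.dia hp' (hdia a))

theorem IsSimulation.logicLE {R : P → P → Prop} {K : Set (HML Act)} (hR : IsSimulation tr R)
    (hK : ∀ p q, R p q → LogicLE tr {σ | SymClosure K σ} p q) {p q : P} (hpq : R p q) :
    LogicLE tr {φ | SimLogic K φ} p q := by
  intro φ hφ hp
  induction hφ generalizing p q with
  | pos σ hσ => exact hK p q hpq σ (.pos σ hσ) hp
  | neg σ hσ => exact hK p q hpq (.neg σ) (.neg σ hσ) hp
  | conj φ _ ih => exact fun i => ih i hpq (hp i)
  | dia a φ _ ih =>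
    obtain ⟨p', hp', hs⟩ := hp
    obtain ⟨q', hq', hpq'⟩ := hR p q hpq a p' hp'
    exact ⟨q', hq', ih hpq' hs⟩

theorem simLogic_inter_dia_mem {K F : Set (HML Act)} (hF : FinitelyClosed F) (a : Act) :
    ∀ φ ∈ {φ | SimLogic K φ} ∩ F, HML.dia a φ ∈ {φ | SimLogic K φ} ∩ F :=
  fun φ hφ => ⟨.dia a φ hφ.1, hF.dia a φ hφ.2⟩

end Simulations

/-! ### The five constraints -/

section Constraints

variable {Act : Type u} {P : Type v} {tr : P → Act → P → Prop} {F : Set (HML Act)} {D : Set P}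

theorem locallySound_universal : LocallySound tr (fun _ => ()) Eq (constraintLogic .U) := by
  rintro p q - _ rfl -
  exact HML.sat_top q

theorem locallyComplete_universal {K : Set (HML Act)} :
    LocallyComplete tr D (fun _ => ()) Eq K :=
  fun _ _ _ _ _ => rfl

instance : IsPartialOrder Bool boolSub where
  refl _ := id
  trans _ _ _ h k := h ∘ k
  antisymm _ _ h k := Bool.eq_iff_iff.2 ⟨k, h⟩

theorem terminated_eq_true {p : P} : terminated tr p = true ↔ ¬ ∃ a p', tr p a p' := by
  rw [terminated, decide_eq_true_iff, Set.eq_empty_iff_forall_notMem, not_exists]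
  rfl

theorem terminated_eq_false_of_step {p p' : P} {a : Act} (h : tr p a p') :
    terminated tr p = false :=
  Bool.eq_false_iff.2 fun hp => terminated_eq_true.1 hp ⟨a, p', h⟩

theorem boolSub_terminated_iff {p q : P} :
    boolSub (terminated tr p) (terminated tr q) ↔
      (HML.nonzero.Sat tr p → HML.nonzero.Sat tr q) := by
  rw [boolSub, terminated_eq_true, terminated_eq_true, HML.sat_nonzero, HML.sat_nonzero,
    not_imp_not]

theorem locallySound_complete : LocallySound tr (terminated tr) boolSub (constraintLogic .C) := by
  rintro p q h _ (rfl | rfl)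
  · exact fun _ => HML.sat_top q
  · exact boolSub_terminated_iff.1 h

theorem locallyComplete_complete (hF : HML.nonzero ∈ F) :
    LocallyComplete tr D (terminated tr) boolSub (constraintLogic .C ∩ F) :=
  fun _ _ _ _ h => boolSub_terminated_iff.2 (h HML.nonzero ⟨Or.inr rfl, hF⟩)

theorem sat_dia_top {a : Act} {p : P} : (HML.dia a .top).Sat tr p ↔ a ∈ initials tr p :=
  exists_congr fun p' => and_iff_left (HML.sat_top p')

theorem locallySound_initials :
    LocallySound tr (initials tr) (· ⊆ ·) (constraintLogic .I) := by
  rintro p q h _ ((rfl | rfl) | ⟨a, rfl⟩)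
  · exact fun _ => HML.sat_top q
  · rw [HML.sat_nonzero, HML.sat_nonzero]
    exact fun ⟨a, ha⟩ => ⟨a, h ha⟩
  · rw [sat_dia_top, sat_dia_top]
    exact fun ha => h ha

theorem locallyComplete_initials (hF : FinitelyClosed F) :
    LocallyComplete tr D (initials tr) (· ⊆ ·) (constraintLogic .I ∩ F) := by
  intro p _ q _ h a ha
  have hmem : HML.dia a .top ∈ constraintLogic .I ∩ F :=
    ⟨Or.inr ⟨a, rfl⟩, hF.dia a _ hF.conj.top_mem⟩
  exact sat_dia_top.1 (h _ hmem (sat_dia_top.2 ha))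

/-- The formula `a₁ ⋯ aₙ ⊤`, which holds at the states with the trace `a₁ ⋯ aₙ`. -/
def traceFormula (α : List Act) : HML Act :=
  α.foldr .dia .top

theorem sat_traceFormula {α : List Act} {p : P} :
    (traceFormula α).Sat tr p ↔ α ∈ traces tr p := by
  induction α generalizing p with
  | nil => exact iff_of_true (HML.sat_top p) ⟨p, .nil p⟩
  | cons a α ih =>
    constructor
    · rintro ⟨p', hp', hs⟩
      obtain ⟨q, hq⟩ := ih.1 hs
      exact ⟨q, .cons hp' hq⟩
    · rintro ⟨q, _ | ⟨hp', hq⟩⟩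
      exact ⟨_, hp', ih.2 ⟨q, hq⟩⟩

theorem traceLogic_traceFormula (α : List Act) : TraceLogic (traceFormula α) := by
  induction α with
  | nil => exact .top
  | cons a α ih => exact .dia a _ ih

theorem TraceLogic.exists_eq_traceFormula {φ : HML Act} (hφ : TraceLogic φ) :
    ∃ α, φ = traceFormula α := by
  induction hφ with
  | top => exact ⟨[], rfl⟩
  | dia a φ _ ih =>
    obtain ⟨α, rfl⟩ := ih
    exact ⟨a :: α, rfl⟩

theorem FinitelyClosed.traceFormula_mem (hF : FinitelyClosed F) (α : List Act) :
    traceFormula α ∈ F := by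
  induction α with
  | nil => exact hF.conj.top_mem
  | cons a α ih => exact hF.dia a _ ih

theorem locallySound_traces : LocallySound tr (traces tr) (· ⊆ ·) (constraintLogic .T) := by
  intro p q h φ hφ
  obtain ⟨α, rfl⟩ := TraceLogic.exists_eq_traceFormula hφ
  rw [sat_traceFormula, sat_traceFormula]
  exact fun hα => h hα

theorem locallyComplete_traces (hF : FinitelyClosed F) :
    LocallyComplete tr D (traces tr) (· ⊆ ·) (constraintLogic .T ∩ F) := by
  intro p _ q _ h α hα
  have hmem : traceFormula α ∈ constraintLogic .T ∩ F :=
    ⟨traceLogic_traceFormula α, hF.traceFormula_mem α⟩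
  exact sat_traceFormula.1 (h _ hmem (sat_traceFormula.2 hα))

instance : IsPartialOrder (Quotient (simSetoid tr)) (simClassLE tr) where
  refl x := x.inductionOn (SimLE.refl tr)
  trans x y z := Quotient.inductionOn₃ x y z fun _ _ _ => SimLE.trans
  antisymm x y := Quotient.inductionOn₂ x y fun _ _ h k => Quotient.sound ⟨h, k⟩

theorem locallySound_simulation :
    LocallySound tr (Quotient.mk (simSetoid tr)) (simClassLE tr) (constraintLogic .S) := by
  rintro p q ⟨R, hR, hpq⟩
  exact hR.logicLE (fun _ _ _ => locallySound_universal.symClosure rfl) hpq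

theorem locallyComplete_simulation (hF : FinitelyClosed F) :
    LocallyComplete tr {p | ImageFinite tr p} (Quotient.mk (simSetoid tr)) (simClassLE tr)
      (constraintLogic .S ∩ F) := fun _ _ _ hq h =>
  ⟨_, isSimulation_logicLE ((ConjClosed.simLogic _).inter hF.conj) (simLogic_inter_dia_mem hF),
    hq, h⟩

end Constraints

/-! ### Linear observations -/

section Linear

variable {Act : Type u} {P : Type v} {L : Type w} {tr : P → Act → P → Prop} {obs : P → L}
  {r : L → L → Prop} {G : HML Act → Prop} {F : Set (HML Act)} {D : Set P}

instance LGO.Along.isPreorder [IsPreorder L r] : IsPreorder (LGO Act L) (LGO.Along r) where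
  refl o := by
    induction o with
    | final l => exact .final (refl_of r l)
    | step l a o ih => exact .step a (refl_of r l) ih
  trans o₁ o₂ o₃ h k := by
    induction h generalizing o₃ with
    | final h =>
      cases k with
      | final k => exact .final (trans_of r h k)
    | step a h _ ih =>
      cases k with
      | step _ k k' => exact .step a (trans_of r h k) (ih _ k')

instance LGO.AtEnd.isPreorder [IsPreorder L r] : IsPreorder (LGO Act L) (LGO.AtEnd r) where
  refl o := by
    induction o with
    | final l => exact .final (refl_of r l)
    | step l a o ih => exact .step l l a ih
  trans o₁ o₂ o₃ h k := by
    induction h generalizing o₃ with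
    | final h =>
      cases k with
      | final k => exact .final (trans_of r h k)
    | step l l' a _ ih =>
      cases k with
      | step _ l'' _ k => exact .step l l'' a (ih _ k)

theorem LGO.along_eq_iff {o o' : LGO Act L} : LGO.Along Eq o o' ↔ o = o' := by
  constructor
  · intro h
    induction h with
    | final h => rw [h]
    | step a h _ ih => rw [h, ih]
  · rintro rfl
    exact refl_of _ o

theorem dominated_along_eq_iff {A B : Set (LGO Act L)} :
    Dominated (LGO.Along Eq) A B ↔ A ⊆ B := by
  simp only [Dominated, LGO.along_eq_iff, exists_eq_right', Set.subset_def]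

theorem dominated_iff_closureBy_subset {X : Type*} {R : X → X → Prop} [IsPreorder X R]
    {A B : Set X} : Dominated R A B ↔ closureBy R A ⊆ closureBy R B := by
  constructor
  · rintro h x ⟨y, hy, hxy⟩
    obtain ⟨z, hz, hyz⟩ := h y hy
    exact ⟨z, hz, trans_of R hxy hyz⟩
  · exact fun h x hx => h ⟨x, hx, refl_of R x⟩

theorem LGO.Along.obs_rel {p q : P} {o o' : LGO Act L} (h : LGO.Along r o o')
    (ho : IsLGO tr obs p o) (ho' : IsLGO tr obs q o') : r (obs p) (obs q) := by
  cases h with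
  | final h => cases ho; cases ho'; exact h
  | step a h _ => cases ho; cases ho'; exact h

theorem AlongLogic.exists_lgo (hG : LocallySound tr obs r {σ | G σ}) {φ : HML Act}
    (hφ : AlongLogic G φ) {p : P} (hp : φ.Sat tr p) :
    ∃ o ∈ lgoSet tr obs p, ∀ q, ∀ o' ∈ lgoSet tr obs q, LGO.Along r o o' → φ.Sat tr q := by
  induction hφ generalizing p with
  | top => exact ⟨_, IsLGO.final p, fun q _ _ _ => HML.sat_top q⟩
  | and σ φ hσ _ ih =>
    obtain ⟨hpσ, hpφ⟩ := HML.sat_and.1 hp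
    obtain ⟨o, ho, h⟩ := ih hpφ
    exact ⟨o, ho, fun q o' ho' hr =>
      HML.sat_and.2 ⟨hG (hr.obs_rel ho ho') σ hσ hpσ, h q o' ho' hr⟩⟩
  | dia a φ _ ih =>
    obtain ⟨p', hp', hs⟩ := hp
    obtain ⟨o, ho, h⟩ := ih hs
    refine ⟨_, IsLGO.step hp' ho, ?_⟩
    rintro q _ (_ | ⟨hq', ho'⟩) (_ | ⟨_, _, hr⟩)
    exact ⟨_, hq', h _ _ ho' hr⟩

theorem AtEndLogic.exists_lgo (hG : LocallySound tr obs r {σ | G σ}) {φ : HML Act}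
    (hφ : AtEndLogic G φ) {p : P} (hp : φ.Sat tr p) :
    ∃ o ∈ lgoSet tr obs p, ∀ q, ∀ o' ∈ lgoSet tr obs q, LGO.AtEnd r o o' → φ.Sat tr q := by
  induction hφ generalizing p with
  | top => exact ⟨_, IsLGO.final p, fun q _ _ _ => HML.sat_top q⟩
  | loc σ hσ =>
    refine ⟨_, IsLGO.final p, ?_⟩
    rintro q _ ho' ⟨hr⟩
    cases ho'
    exact hG hr σ hσ hp
  | dia a φ _ ih =>
    obtain ⟨p', hp', hs⟩ := hp
    obtain ⟨o, ho, h⟩ := ih hs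
    refine ⟨_, IsLGO.step hp' ho, ?_⟩
    rintro q _ (_ | ⟨hq', ho'⟩) (_ | ⟨_, _, _, hr⟩)
    exact ⟨_, hq', h _ _ ho' hr⟩

theorem logicLE_of_dominated_along (hG : LocallySound tr obs r {σ | G σ}) {p q : P}
    (h : Dominated (LGO.Along r) (lgoSet tr obs p) (lgoSet tr obs q)) :
    LogicLE tr {φ | AlongLogic G φ} p q := by
  intro φ hφ hp
  obtain ⟨o, ho, hforce⟩ := AlongLogic.exists_lgo hG hφ hp
  obtain ⟨o', ho', hr⟩ := h o ho
  exact hforce q o' ho' hr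

theorem logicLE_of_dominated_atEnd (hG : LocallySound tr obs r {σ | G σ}) {p q : P}
    (h : Dominated (LGO.AtEnd r) (lgoSet tr obs p) (lgoSet tr obs q)) :
    LogicLE tr {φ | AtEndLogic G φ} p q := by
  intro φ hφ hp
  obtain ⟨o, ho, hforce⟩ := AtEndLogic.exists_lgo hG hφ hp
  obtain ⟨o', ho', hr⟩ := h o ho
  exact hforce q o' ho' hr

theorem IsLGO.enforces_along (hD : Admissible tr D) (hF : FinitelyClosed F)
    (hG : ConjClosed {σ | G σ}) (hcomplete : LocallyComplete tr D obs r ({σ | G σ} ∩ F))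
    {p : P} (hp : p ∈ D) {o : LGO Act L} (ho : IsLGO tr obs p o) {Q : Set P}
    (hQ : ImageFiniteSet tr Q) :
    Enforces tr ({φ | AlongLogic G φ} ∩ F) p Q fun q => ∃ o' ∈ lgoSet tr obs q, o.Along r o' := by
  have hloc {p : P} (hp : p ∈ D) {Q : Set P} (hQ : ImageFiniteSet tr Q) :=
    hcomplete.enforces (hG.inter hF.conj) hD hp hQ
  induction ho generalizing Q with
  | final p =>
    obtain ⟨σ, hσ, hσp, hσQ⟩ := hloc hp hQ
    refine ⟨σ.and .top, ⟨.and σ .top hσ.1 .top, hF.conj.and_mem hσ.2 hF.conj.top_mem⟩,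
      HML.sat_and.2 ⟨hσp, HML.sat_top p⟩, fun q hq hs => ?_⟩
    exact ⟨_, IsLGO.final q, .final (hσQ q hq (HML.sat_and.1 hs).1)⟩
  | @step p p' a o hp' _ ih =>
    have hstep := (ih (hD.of_step hp hp') (hQ.successors a)).dia
      (H := {φ | AlongLogic G φ} ∩ F) hp' fun φ hφ => ⟨.dia a φ hφ.1, hF.dia a φ hφ.2⟩
    have hboth := (hloc hp hQ).and (H := {φ | AlongLogic G φ} ∩ F) hstep
      fun σ hσ φ hφ => ⟨.and σ φ hσ.1 hφ.1, hF.conj.and_mem hσ.2 hφ.2⟩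
    refine hboth.imp ?_
    rintro q ⟨hr, q', hq', o', ho', hr'⟩
    exact ⟨_, IsLGO.step hq' ho', .step a hr hr'⟩

theorem IsLGO.enforces_atEnd (hD : Admissible tr D) (hF : FinitelyClosed F)
    (hG : ConjClosed {σ | G σ}) (hcomplete : LocallyComplete tr D obs r ({σ | G σ} ∩ F))
    {p : P} (hp : p ∈ D) {o : LGO Act L} (ho : IsLGO tr obs p o) {Q : Set P}
    (hQ : ImageFiniteSet tr Q) :
    Enforces tr ({φ | AtEndLogic G φ} ∩ F) p Q fun q => ∃ o' ∈ lgoSet tr obs q, o.AtEnd r o' := by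
  induction ho generalizing Q with
  | final p =>
    obtain ⟨σ, hσ, hσp, hσQ⟩ := hcomplete.enforces (hG.inter hF.conj) hD hp hQ
    exact ⟨σ, ⟨.loc σ hσ.1, hσ.2⟩, hσp,
      fun q hq hs => ⟨_, IsLGO.final q, .final (hσQ q hq hs)⟩⟩
  | @step p p' a o hp' _ ih =>
    have hstep := (ih (hD.of_step hp hp') (hQ.successors a)).dia
      (H := {φ | AtEndLogic G φ} ∩ F) hp' fun φ hφ => ⟨.dia a φ hφ.1, hF.dia a φ hφ.2⟩
    refine hstep.imp ?_
    rintro q ⟨q', hq', o', ho', hr⟩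
    exact ⟨_, IsLGO.step hq' ho', .step _ _ a hr⟩

theorem dominated_along_of_logicLE (hD : Admissible tr D) (hF : FinitelyClosed F)
    (hG : ConjClosed {σ | G σ}) (hcomplete : LocallyComplete tr D obs r ({σ | G σ} ∩ F))
    {p q : P} (hp : p ∈ D) (hq : ImageFinite tr q)
    (h : LogicLE tr ({φ | AlongLogic G φ} ∩ F) p q) :
    Dominated (LGO.Along r) (lgoSet tr obs p) (lgoSet tr obs q) :=
  fun _ ho => h.of_enforces (IsLGO.enforces_along hD hF hG hcomplete hp ho hq.singleton)

theorem dominated_atEnd_of_logicLE (hD : Admissible tr D) (hF : FinitelyClosed F)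
    (hG : ConjClosed {σ | G σ}) (hcomplete : LocallyComplete tr D obs r ({σ | G σ} ∩ F))
    {p q : P} (hp : p ∈ D) (hq : ImageFinite tr q)
    (h : LogicLE tr ({φ | AtEndLogic G φ} ∩ F) p q) :
    Dominated (LGO.AtEnd r) (lgoSet tr obs p) (lgoSet tr obs q) :=
  fun _ ho => h.of_enforces (IsLGO.enforces_atEnd hD hF hG hcomplete hp ho hq.singleton)

end Linear

section Complete

variable {Act : Type u} {P : Type v} {tr : P → Act → P → Prop}

theorem Dominated.imp {X : Type*} {R R' : X → X → Prop} {A B : Set X} (h : Dominated R A B)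
    (hR : ∀ x y, R x y → R' x y) : Dominated R' A B := fun x hx =>
  let ⟨y, hy, hxy⟩ := h x hx
  ⟨y, hy, hR x y hxy⟩

theorem LGO.Along.mono {L : Type w} {r r' : L → L → Prop} (hr : ∀ l l', r l l' → r' l l')
    {o o' : LGO Act L} (h : LGO.Along r o o') : LGO.Along r' o o' := by
  induction h with
  | final h => exact .final (hr _ _ h)
  | step a h _ ih => exact .step a (hr _ _ h) ih

theorem LGO.AtEnd.mono {L : Type w} {r r' : L → L → Prop} (hr : ∀ l l', r l l' → r' l l')
    {o o' : LGO Act L} (h : LGO.AtEnd r o o') : LGO.AtEnd r' o o' := by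
  induction h with
  | final h => exact .final (hr _ _ h)
  | step l l' a _ ih => exact .step l l' a ih

theorem swap_boolSub_of_eq (b b' : Bool) (h : b = b') : Function.swap boolSub b b' :=
  h ▸ refl_of boolSub b

theorem eq_of_swap_boolSub {p q : P} (hp : ¬ ∃ a p', tr p a p')
    (h : Function.swap boolSub (terminated tr p) (terminated tr q)) :
    terminated tr p = terminated tr q :=
  (terminated_eq_true.2 hp).trans (h (terminated_eq_true.2 hp)).symm

/-- An observation of a state that can act at its end is extended by one more step: an
observation dominating the extension shows an action at the same place. -/
theorem IsLGO.exists_along_eq {p : P} {o : LGO Act Bool} (ho : IsLGO tr (terminated tr) p o) :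
    ∃ x ∈ lgoSet tr (terminated tr) p, ∀ q, ∀ y ∈ lgoSet tr (terminated tr) q,
      LGO.Along (Function.swap boolSub) x y →
        ∃ o' ∈ lgoSet tr (terminated tr) q, LGO.Along Eq o o' := by
  induction ho with
  | final p =>
    by_cases hp : ∃ a p', tr p a p'
    · obtain ⟨a, p', hp'⟩ := hp
      refine ⟨_, IsLGO.step hp' (.final p'), ?_⟩
      rintro q _ (_ | ⟨hq', _⟩) (_ | _)
      refine ⟨_, IsLGO.final q, .final ?_⟩
      rw [terminated_eq_false_of_step hp', terminated_eq_false_of_step hq']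
    · refine ⟨_, IsLGO.final p, fun q y hy h => ⟨_, IsLGO.final q, .final ?_⟩⟩
      exact eq_of_swap_boolSub hp (h.obs_rel (IsLGO.final p) hy)
  | step hp' _ ih =>
    obtain ⟨x, hx, h⟩ := ih
    refine ⟨_, IsLGO.step hp' hx, ?_⟩
    rintro q _ (_ | ⟨hq', hy⟩) (_ | ⟨_, _, hxy⟩)
    obtain ⟨o', ho', hoo'⟩ := h _ _ hy hxy
    refine ⟨_, IsLGO.step hq' ho', .step _ ?_ hoo'⟩
    rw [terminated_eq_false_of_step hp', terminated_eq_false_of_step hq']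

theorem IsLGO.exists_atEnd_eq {p : P} {o : LGO Act Bool} (ho : IsLGO tr (terminated tr) p o) :
    ∃ x ∈ lgoSet tr (terminated tr) p, ∀ q, ∀ y ∈ lgoSet tr (terminated tr) q,
      LGO.AtEnd (Function.swap boolSub) x y →
        ∃ o' ∈ lgoSet tr (terminated tr) q, LGO.AtEnd Eq o o' := by
  induction ho with
  | final p =>
    by_cases hp : ∃ a p', tr p a p'
    · obtain ⟨a, p', hp'⟩ := hp
      refine ⟨_, IsLGO.step hp' (.final p'), ?_⟩
      rintro q _ (_ | ⟨hq', _⟩) (_ | _)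
      refine ⟨_, IsLGO.final q, .final ?_⟩
      rw [terminated_eq_false_of_step hp', terminated_eq_false_of_step hq']
    · refine ⟨_, IsLGO.final p, ?_⟩
      rintro q _ hy ⟨h⟩
      cases hy
      exact ⟨_, IsLGO.final q, .final (eq_of_swap_boolSub hp h)⟩
  | step hp' _ ih =>
    obtain ⟨x, hx, h⟩ := ih
    refine ⟨_, IsLGO.step hp' hx, ?_⟩
    rintro q _ (_ | ⟨hq', hy⟩) (_ | ⟨_, _, _, hxy⟩)
    obtain ⟨o', ho', hoo'⟩ := h _ _ hy hxy
    exact ⟨_, IsLGO.step hq' ho', .step _ _ _ hoo'⟩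

theorem dominated_along_swap_boolSub_iff {p q : P} :
    Dominated (LGO.Along (Function.swap boolSub)) (lgoSet tr (terminated tr) p)
        (lgoSet tr (terminated tr) q) ↔
      Dominated (LGO.Along Eq) (lgoSet tr (terminated tr) p) (lgoSet tr (terminated tr) q) := by
  refine ⟨fun h o ho => ?_, fun h => h.imp fun _ _ => .mono swap_boolSub_of_eq⟩
  obtain ⟨x, hx, hforce⟩ := IsLGO.exists_along_eq ho
  obtain ⟨y, hy, hxy⟩ := h x hx
  exact hforce q y hy hxy

theorem dominated_atEnd_swap_boolSub_iff {p q : P} :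
    Dominated (LGO.AtEnd (Function.swap boolSub)) (lgoSet tr (terminated tr) p)
        (lgoSet tr (terminated tr) q) ↔
      Dominated (LGO.AtEnd Eq) (lgoSet tr (terminated tr) p) (lgoSet tr (terminated tr) q) := by
  refine ⟨fun h o ho => ?_, fun h => h.imp fun _ _ => .mono swap_boolSub_of_eq⟩
  obtain ⟨x, hx, hforce⟩ := IsLGO.exists_atEnd_eq ho
  obtain ⟨y, hy, hxy⟩ := h x hx
  exact hforce q y hy hxy

theorem obsLEWith_swap_boolSub_iff {Y : SemKind} {p q : P} :
    obsLEWith tr (terminated tr) (Function.swap boolSub) boolSub Y p q ↔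
      obsLEWith tr (terminated tr) Eq boolSub Y p q := by
  cases Y with
  | failureTrace => exact dominated_along_swap_boolSub_iff
  | failures => exact dominated_atEnd_swap_boolSub_iff
  | _ => rfl

end Complete

/-! ### Branching observations -/

section Branching

variable {Act : Type u} {P : Type v} {L : Type w} {tr : P → Act → P → Prop} {obs : P → L}
  {K F : Set (HML Act)} {D : Set P}

theorem node_mem_bgoSet {p : P} {l : L} {S : Finset (Act × BGO Act L)} :
    BGO.node l S ∈ bgoSet tr obs p ↔
      l = obs p ∧ ∀ c ∈ S, ∃ p', tr p c.1 p' ∧ c.2 ∈ bgoSet tr obs p' := by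
  constructor
  · intro h
    generalize hx : BGO.node l S = x at h
    obtain ⟨_, S', p', h₁, h₂⟩ := h
    obtain ⟨rfl, rfl⟩ := BGO.node_inj.1 hx
    exact ⟨rfl, fun c hc => ⟨p' c, h₁ c hc, h₂ c hc⟩⟩
  · rintro ⟨rfl, h⟩
    have : Nonempty P := ⟨p⟩
    choose! p' h₁ h₂ using h
    exact IsBGO.node p S p' h₁ h₂

theorem exists_node_of_mem_bgoSet {p : P} {o : BGO Act L} (ho : o ∈ bgoSet tr obs p) :
    ∃ S, o = BGO.node (obs p) S := by
  cases ho with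
  | node _ S => exact ⟨S, rfl⟩

theorem leaf_mem_bgoSet (p : P) : BGO.node (obs p) ∅ ∈ bgoSet tr obs p :=
  node_mem_bgoSet.2 ⟨rfl, by simp⟩

theorem obs_eq_of_mem_bgoSet {p q : P} {o : BGO Act L} (hp : o ∈ bgoSet tr obs p)
    (hq : o ∈ bgoSet tr obs q) : obs p = obs q := by
  obtain ⟨S, rfl⟩ := exists_node_of_mem_bgoSet hp
  exact (node_mem_bgoSet.1 hq).1

theorem bgoSet_subset_of_isSimulation {R : P → P → Prop} (hR : IsSimulation tr R)
    (hobs : ∀ p q, R p q → obs p = obs q) {p q : P} (hpq : R p q) :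
    bgoSet tr obs p ⊆ bgoSet tr obs q := by
  intro o ho
  induction ho generalizing q with
  | node p S p' hp' _ ih =>
    refine node_mem_bgoSet.2 ⟨hobs p q hpq, fun c hc => ?_⟩
    obtain ⟨q', hq', hpq'⟩ := hR p q hpq c.1 (p' c) (hp' c hc)
    exact ⟨q', hq', ih c hc hpq'⟩

/-- Any two observations of a state can be merged by uniting the sets of children of the root. -/
theorem directed_bgoSet (p : P) :
    Directed (· ⊇ ·) fun o : bgoSet tr obs p => {q | o.1 ∈ bgoSet tr obs q} := by
  classical
  rintro ⟨o₁, h₁⟩ ⟨o₂, h₂⟩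
  obtain ⟨S₁, rfl⟩ := exists_node_of_mem_bgoSet h₁
  obtain ⟨S₂, rfl⟩ := exists_node_of_mem_bgoSet h₂
  have hunion (q : P) : BGO.node (obs p) (S₁ ∪ S₂) ∈ bgoSet tr obs q ↔
      BGO.node (obs p) S₁ ∈ bgoSet tr obs q ∧ BGO.node (obs p) S₂ ∈ bgoSet tr obs q := by
    simp only [node_mem_bgoSet, Finset.mem_union, or_imp, forall_and]
    tauto
  exact ⟨⟨_, (hunion p).2 ⟨h₁, h₂⟩⟩, fun q hq => ((hunion q).1 hq).1,
    fun q hq => ((hunion q).1 hq).2⟩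

theorem isSimulation_bgoSet_subset (tr : P → Act → P → Prop) (obs : P → L) :
    IsSimulation tr fun p q => ImageFinite tr q ∧ bgoSet tr obs p ⊆ bgoSet tr obs q := by
  rintro p q ⟨hq, hpq⟩ a p' hp'
  by_contra! hcon
  have hmissing (q' : P) : ∃ o : bgoSet tr obs p', tr q a q' → o.1 ∉ bgoSet tr obs q' := by
    by_cases hq' : tr q a q'
    · obtain ⟨o, ho, hoq⟩ := Set.not_subset.1 (hcon q' hq' (hq.of_step hq'))
      exact ⟨⟨o, ho⟩, fun _ => hoq⟩
    · exact ⟨⟨_, leaf_mem_bgoSet p'⟩, fun h => absurd h hq'⟩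
  choose o ho using hmissing
  have : Nonempty (bgoSet tr obs p') := ⟨⟨_, leaf_mem_bgoSet p'⟩⟩
  obtain ⟨m, hm⟩ := (directed_bgoSet p').finite_set_le ((hq.finite_succ a).image o)
  have hmp : BGO.node (obs p) {(a, m.1)} ∈ bgoSet tr obs p :=
    node_mem_bgoSet.2 ⟨rfl, by simpa using ⟨p', hp', m.2⟩⟩
  obtain ⟨q', hq', hmq'⟩ := (node_mem_bgoSet.1 (hpq hmp)).2 _ (Finset.mem_singleton_self _)
  exact ho q' hq' (hm (o q') (Set.mem_image_of_mem o hq') hmq')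

theorem logicLE_of_bgoSet_subset (hK : LocallySound tr obs Eq {σ | SymClosure K σ}) {p q : P}
    (hq : ImageFinite tr q) (h : bgoSet tr obs p ⊆ bgoSet tr obs q) :
    LogicLE tr {φ | SimLogic K φ} p q :=
  (isSimulation_bgoSet_subset tr obs).logicLE
    (fun p _ hpq => hK (obs_eq_of_mem_bgoSet (leaf_mem_bgoSet p) (hpq.2 (leaf_mem_bgoSet p))))
    ⟨hq, h⟩

theorem SymClosure.simLogic {σ : HML Act} (h : SymClosure K σ) : SimLogic K σ := by
  induction h with
  | pos σ h => exact .pos σ h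
  | neg σ h => exact .neg σ h
  | conj σ _ ih => exact .conj σ ih

theorem bgoSet_subset_of_logicLE (hD : Admissible tr D) (hF : FinitelyClosed F)
    (hcomplete : LocallyComplete tr D obs Eq ({σ | SymClosure K σ} ∩ F)) {p q : P}
    (hp : p ∈ D) (hq : ImageFinite tr q) (h : LogicLE tr ({φ | SimLogic K φ} ∩ F) p q) :
    bgoSet tr obs p ⊆ bgoSet tr obs q := by
  have hsim := isSimulation_logicLE (tr := tr) ((ConjClosed.simLogic K).inter hF.conj)
    (simLogic_inter_dia_mem hF)
  have hsimD : IsSimulation tr fun p q =>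
      p ∈ D ∧ ImageFinite tr q ∧ LogicLE tr ({φ | SimLogic K φ} ∩ F) p q := by
    rintro p q ⟨hp, hpq⟩ a p' hp'
    obtain ⟨q', hq', hpq'⟩ := hsim p q hpq a p' hp'
    exact ⟨q', hq', hD.of_step hp hp', hpq'⟩
  refine bgoSet_subset_of_isSimulation hsimD ?_ ⟨hp, hq, h⟩
  rintro p q ⟨hp, hq, h⟩
  exact hcomplete hp (hD.of_imageFinite hq) fun σ hσ => h σ ⟨hσ.1.simLogic, hσ.2⟩

end Branching

/-! ### Deterministic branching observations -/

section Deterministic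

variable {Act : Type u} {P : Type v} {L : Type w} {tr : P → Act → P → Prop} {obs : P → L}
  {F : Set (HML Act)} {G : HML Act → Prop} {D : Set P}

theorem BGO.deterministic_node {l : L} {S : Finset (Act × BGO Act L)} :
    (BGO.node l S).Deterministic ↔
      (∀ c ∈ S, ∀ d ∈ S, c.1 = d.1 → c = d) ∧ ∀ c ∈ S, c.2.Deterministic := by
  constructor
  · intro h
    generalize hx : BGO.node l S = x at h
    obtain ⟨_, S', h₁, h₂⟩ := h
    obtain ⟨rfl, rfl⟩ := BGO.node_inj.1 hx
    exact ⟨h₁, h₂⟩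
  · exact fun h => .node l S h.1 h.2

theorem node_mem_dbgoSet {p : P} {l : L} {S : Finset (Act × BGO Act L)} :
    BGO.node l S ∈ dbgoSet tr obs p ↔
      l = obs p ∧ (∀ c ∈ S, ∀ d ∈ S, c.1 = d.1 → c = d) ∧
        ∀ c ∈ S, ∃ p', tr p c.1 p' ∧ c.2 ∈ dbgoSet tr obs p' := by
  simp only [dbgoSet, Set.mem_inter_iff, node_mem_bgoSet, Set.mem_ofPred_eq,
    BGO.deterministic_node, ← and_assoc, exists_and_right, forall_and]
  tauto

/-- The deterministic observation with root label `l` and, for every `a ∈ A`, an `a`-arc to the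
subtree `o a`. -/
noncomputable def BGO.detNode (l : L) (A : Finset Act) (o : Act → BGO Act L) : BGO Act L :=
  open Classical in BGO.node l (A.image fun a => (a, o a))

theorem detNode_mem_dbgoSet {p : P} {l : L} {A : Finset Act} {o : Act → BGO Act L} :
    BGO.detNode l A o ∈ dbgoSet tr obs p ↔
      l = obs p ∧ ∀ a ∈ A, ∃ p', tr p a p' ∧ o a ∈ dbgoSet tr obs p' := by
  simp +contextual [BGO.detNode, node_mem_dbgoSet]

/-- Satisfaction restricted to the actions in `A`: outside the scope of a negation, the
subformulas `aφ` with `a ∉ A` are taken to be true. A deterministic observation, having finitely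
many arcs, can only witness this weaker relation when a conjunction is infinite. -/
def HML.SatOn (tr : P → Act → P → Prop) (A : Finset Act) : HML Act → P → Prop
  | .conj φ, p => ∀ i, HML.SatOn tr A (φ i) p
  | .dia a φ, p => a ∈ A → ∃ q, tr p a q ∧ HML.SatOn tr A φ q
  | .neg φ, p => ¬ φ.Sat tr p

theorem HML.Sat.satOn {φ : HML Act} {p : P} (h : φ.Sat tr p) (A : Finset Act) :
    φ.SatOn tr A p := by
  induction φ generalizing p with
  | conj φ ih => exact fun i => ih i (h i)
  | dia a φ ih => exact fun _ => h.imp fun q hq => ⟨hq.1, ih hq.2⟩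
  | neg φ _ => exact h

theorem HML.satOn_and {φ ψ : HML Act} {A : Finset Act} {p : P} :
    (φ.and ψ).SatOn tr A p ↔ φ.SatOn tr A p ∧ ψ.SatOn tr A p := by
  simp [HML.and, HML.SatOn, ULift.forall, and_comm]

theorem HML.SatOn.anti {φ : HML Act} {A B : Finset Act} (hAB : A ⊆ B) {p : P}
    (h : φ.SatOn tr B p) : φ.SatOn tr A p := by
  induction φ generalizing p with
  | conj φ ih => exact fun i => ih i (h i)
  | dia a φ ih => exact fun ha => (h (hAB ha)).imp fun q hq => ⟨hq.1, ih hq.2⟩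
  | neg φ _ => exact h

theorem ImageFinite.sat_of_forall_satOn {φ : HML Act} {p : P} (hp : ImageFinite tr p)
    (h : ∀ A, φ.SatOn tr A p) : φ.Sat tr p := by
  classical
  induction φ generalizing p with
  | conj φ ih => exact fun i => ih i hp fun A => h A i
  | neg φ _ => exact h ∅
  | dia a φ ih =>
    by_contra! hcon
    have hfail (q : P) : ∃ A, tr p a q → ¬ φ.SatOn tr A q := by
      by_cases hq : tr p a q
      · obtain ⟨A, hA⟩ := not_forall.1 fun hall => hcon ⟨q, hq, ih (hp.of_step hq) hall⟩
        exact ⟨A, fun _ => hA⟩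
      · exact ⟨∅, fun h => absurd h hq⟩
    choose A hA using hfail
    let B := insert a ((hp.finite_succ a).toFinset.biUnion A)
    obtain ⟨q, hq, hs⟩ := h B (Finset.mem_insert_self a _)
    have hAB : A q ⊆ B := (Finset.subset_biUnion_of_mem A (by simpa using hq)).trans
      (Finset.subset_insert a _)
    exact hA q hq (hs.anti hAB)

theorem DetLogic.exists_dbgo (hG : LocallySound tr obs Eq {σ | G σ}) (A : Finset Act)
    {φ : HML Act} (hφ : DetLogic G φ) {p : P} (hp : φ.Sat tr p) :
    ∃ o ∈ dbgoSet tr obs p, ∀ q, o ∈ dbgoSet tr obs q → φ.SatOn tr A q := by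
  classical
  induction hφ generalizing p with
  | top =>
    exact ⟨.node (obs p) ∅, node_mem_dbgoSet.2 ⟨rfl, by simp⟩, fun q _ => (HML.sat_top q).satOn A⟩
  | and σ φ hσ _ ih =>
    obtain ⟨hpσ, hpφ⟩ := HML.sat_and.1 hp
    obtain ⟨o, ho, h⟩ := ih hpφ
    refine ⟨o, ho, fun q hq => HML.satOn_and.2 ⟨?_, h q hq⟩⟩
    exact (hG (obs_eq_of_mem_bgoSet ho.1 hq.1) σ hσ hpσ).satOn A
  | branch X φ _ ih =>
    have hbranch (a : Act) (ha : a ∈ X) : ∃ p' o, tr p a p' ∧ o ∈ dbgoSet tr obs p' ∧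
        ∀ q, o ∈ dbgoSet tr obs q → (φ ⟨a, ha⟩).SatOn tr A q := by
      obtain ⟨p', hp', hs⟩ := hp ⟨a, ha⟩
      obtain ⟨o, ho, h⟩ := ih ⟨a, ha⟩ hs
      exact ⟨p', o, hp', ho, h⟩
    have : Nonempty P := ⟨p⟩
    have : Nonempty (BGO Act L) := ⟨.node (obs p) ∅⟩
    choose! p' o hp' ho h using hbranch
    refine ⟨.detNode (obs p) (A.filter (· ∈ X)) o, detNode_mem_dbgoSet.2 ⟨rfl, fun a ha => ?_⟩,
      fun q hq a haA => ?_⟩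
    · have haX := (Finset.mem_filter.1 ha).2
      exact ⟨p' a, hp' a haX, ho a haX⟩
    · obtain ⟨q', hq', hoq'⟩ := (detNode_mem_dbgoSet.1 hq).2 a (Finset.mem_filter.2 ⟨haA, a.2⟩)
      exact ⟨q', hq', h a a.2 q' hoq'⟩

theorem logicLE_of_dbgoSet_subset (hG : LocallySound tr obs Eq {σ | G σ}) {p q : P}
    (hq : ImageFinite tr q) (h : dbgoSet tr obs p ⊆ dbgoSet tr obs q) :
    LogicLE tr {φ | DetLogic G φ} p q := by
  refine fun φ hφ hp => hq.sat_of_forall_satOn fun A => ?_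
  obtain ⟨o, ho, hforce⟩ := DetLogic.exists_dbgo hG A hφ hp
  exact hforce q (h ho)

theorem DetLogic.enforces_dbgo (hD : Admissible tr D) (hF : FinitelyClosed F)
    (hG : ConjClosed {σ | G σ}) (hcomplete : LocallyComplete tr D obs Eq ({σ | G σ} ∩ F))
    {p : P} (hp : p ∈ D) {o : BGO Act L} (ho : o ∈ dbgoSet tr obs p) {Q : Set P}
    (hQ : ImageFiniteSet tr Q) :
    Enforces tr ({φ | DetLogic G φ} ∩ F) p Q fun q => o ∈ dbgoSet tr obs q := by
  induction o using BGO.induction generalizing p Q with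
  | h l S ih =>
    obtain ⟨rfl, hinj, hS⟩ := node_mem_dbgoSet.1 ho
    let X : Set Act := Prod.fst '' (S : Set (Act × BGO Act L))
    have : Finite X := S.finite_toSet.image _
    choose c hc hca using fun a : X => a.2
    have hchildren : Enforces tr ({φ | DetLogic G φ} ∩ F) p Q
        fun q => ∀ a : X, ∃ q', tr q a q' ∧ (c a).2 ∈ dbgoSet tr obs q' := by
      refine Enforces.branch (H₁ := {φ | DetLogic G φ} ∩ F) (fun a => ?_) fun φ hφ => ?_
      · obtain ⟨p', hp', hop'⟩ := hS (c a) (hc a)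
        rw [hca] at hp'
        exact ⟨p', hp', ih _ (hc a) (hD.of_step hp hp') hop' (hQ.successors a)⟩
      · exact ⟨.branch X φ fun a => (hφ a).1, hF.conj _ fun a => hF.dia a _ (hφ a).2⟩
    have hboth := (hcomplete.enforces (hG.inter hF.conj) hD hp hQ).and
      (H := {φ | DetLogic G φ} ∩ F) hchildren
      fun σ hσ φ hφ => ⟨.and σ φ hσ.1 hφ.1, hF.conj.and_mem hσ.2 hφ.2⟩
    refine hboth.imp ?_
    rintro q ⟨hobs, hq⟩
    refine node_mem_dbgoSet.2 ⟨hobs, hinj, fun d hd => ?_⟩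
    let a : X := ⟨d.1, d, hd, rfl⟩
    have hcd : c a = d := hinj _ (hc a) d hd (hca a)
    simpa only [hcd] using hq a

theorem dbgoSet_subset_of_logicLE (hD : Admissible tr D) (hF : FinitelyClosed F)
    (hG : ConjClosed {σ | G σ}) (hcomplete : LocallyComplete tr D obs Eq ({σ | G σ} ∩ F))
    {p q : P} (hp : p ∈ D) (hq : ImageFinite tr q)
    (h : LogicLE tr ({φ | DetLogic G φ} ∩ F) p q) : dbgoSet tr obs p ⊆ dbgoSet tr obs q :=
  fun _ ho => h.of_enforces (DetLogic.enforces_dbgo hD hF hG hcomplete hp ho hq.singleton)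

end Deterministic

/-! ### All kinds of semantics -/

section Unified

variable {Act : Type u} {P : Type v} {L : Type w} {tr : P → Act → P → Prop} {obs : P → L}
  {sup sub : L → L → Prop} {F : Set (HML Act)} {D : Set P} {N : Constraint}

theorem obsLEWith_iff_obsInclWith [IsPreorder L sup] [IsPreorder L sub] {Y : SemKind} {p q : P} :
    obsLEWith tr obs sup sub Y p q ↔ obsInclWith tr obs sup sub Y p q := by
  cases Y with
  | simulation | readyTrace | deterministic => rfl
  | _ => exact dominated_iff_closureBy_subset

theorem logicLE_of_obsLEWith [Std.Refl sub] (hsound : LocallySound tr obs sub (constraintLogic N))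
    {Y : SemKind} {p q : P} (hq : ImageFinite tr q)
    (h : obsLEWith tr obs (Function.swap sub) sub Y p q) : LogicLE tr (unifiedLogic N Y) p q := by
  cases Y with
  | simulation => exact logicLE_of_bgoSet_subset hsound.symClosure hq h
  | readyTrace => exact logicLE_of_dominated_along hsound.symClosure (dominated_along_eq_iff.2 h)
  | failureTrace => exact logicLE_of_dominated_along hsound.negClosure h
  | readiness => exact logicLE_of_dominated_atEnd hsound.symClosure h
  | failures => exact logicLE_of_dominated_atEnd hsound.negClosure h
  | partialOfferTrace => exact logicLE_of_dominated_along hsound.posClosure h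
  | partialOffer => exact logicLE_of_dominated_atEnd hsound.posClosure h
  | deterministic => exact logicLE_of_dbgoSet_subset hsound.symClosure hq h

theorem obsLEWith_of_logicLE [Std.Antisymm sub] (hD : Admissible tr D) (hF : FinitelyClosed F)
    (hcomplete : LocallyComplete tr D obs sub (constraintLogic N ∩ F)) {Y : SemKind} {p q : P}
    (hp : p ∈ D) (hq : ImageFinite tr q) (h : LogicLE tr (unifiedLogic N Y ∩ F) p q) :
    obsLEWith tr obs (Function.swap sub) sub Y p q := by
  have hsym := hcomplete.symClosure hF
  have hneg := hcomplete.negClosure hF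
  have hpos := hcomplete.posClosure
  cases Y with
  | simulation => exact bgoSet_subset_of_logicLE hD hF hsym hp hq h
  | readyTrace =>
    exact dominated_along_eq_iff.1 (dominated_along_of_logicLE hD hF (.symClosure _) hsym hp hq h)
  | failureTrace => exact dominated_along_of_logicLE hD hF (.negClosure _) hneg hp hq h
  | readiness => exact dominated_atEnd_of_logicLE hD hF (.symClosure _) hsym hp hq h
  | failures => exact dominated_atEnd_of_logicLE hD hF (.negClosure _) hneg hp hq h
  | partialOfferTrace => exact dominated_along_of_logicLE hD hF (.posClosure _) hpos hp hq h
  | partialOffer => exact dominated_atEnd_of_logicLE hD hF (.posClosure _) hpos hp hq h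
  | deterministic => exact dbgoSet_subset_of_logicLE hD hF (.symClosure _) hsym hp hq h

theorem logicLE_iff_obsLEWith [IsPartialOrder L sub] (hD : Admissible tr D)
    (hF : FinitelyClosed F) (hsound : LocallySound tr obs sub (constraintLogic N))
    (hcomplete : LocallyComplete tr D obs sub (constraintLogic N ∩ F)) {Y : SemKind} {p q : P}
    (hp : p ∈ D) (hq : ImageFinite tr q) :
    LogicLE tr (unifiedLogic N Y ∩ F) p q ↔ obsLEWith tr obs (Function.swap sub) sub Y p q :=
  ⟨obsLEWith_of_logicLE hD hF hcomplete hp hq,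
    fun h => (logicLE_of_obsLEWith hsound hq h).mono Set.inter_subset_left⟩

theorem logicLE_iff_obsLE (hF : FinitelyClosed F) (hC : N = .C → HML.nonzero ∈ F) {Y : SemKind}
    {p q : P} (hp : N = .S → ImageFinite tr p) (hq : ImageFinite tr q) :
    LogicLE tr (unifiedLogic N Y ∩ F) p q ↔ ObsLE tr N Y p q := by
  have huniv := Admissible.univ tr
  cases N with
  | U =>
    have : IsPartialOrder Unit Eq := { antisymm := fun _ _ h _ => h }
    have key := logicLE_iff_obsLEWith (Y := Y) huniv hF locallySound_universal
      locallyComplete_universal (Set.mem_univ p) hq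
    rwa [Std.Symm.swap_eq] at key
  | C =>
    exact (logicLE_iff_obsLEWith huniv hF locallySound_complete
      (locallyComplete_complete (hC rfl)) (Set.mem_univ p) hq).trans obsLEWith_swap_boolSub_iff
  | I =>
    exact logicLE_iff_obsLEWith huniv hF locallySound_initials (locallyComplete_initials hF)
      (Set.mem_univ p) hq
  | T =>
    exact logicLE_iff_obsLEWith huniv hF locallySound_traces (locallyComplete_traces hF)
      (Set.mem_univ p) hq
  | S =>
    exact logicLE_iff_obsLEWith (.imageFinite tr) hF locallySound_simulation
      (locallyComplete_simulation hF) (hp rfl) hq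

theorem obsLE_iff_obsIncl {Y : SemKind} {p q : P} : ObsLE tr N Y p q ↔ ObsIncl tr N Y p q := by
  cases N with
  | U | C => exact obsLEWith_iff_obsInclWith
  | I | T => exact obsLEWith_iff_obsInclWith (L := Set _) (sup := Function.swap (· ⊆ ·))
  | S => exact obsLEWith_iff_obsInclWith (sup := Function.swap (simClassLE tr))

end Unified

theorem mainTheorem3_general {Act P : Type*} (tr : P → Act → P → Prop) (N : Constraint)
    (Y : SemKind) (p q : P) (hp : N = Constraint.S → ImageFinite tr p) (hq : ImageFinite tr q) :
    (LogicLE tr (unifiedLogic N Y) p q ↔ ObsLE tr N Y p q) ∧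
    ((N = Constraint.C → Finite Act) →
      (LogicLE tr (finitaryLogic N Y) p q ↔ ObsLE tr N Y p q)) ∧
    (ObsLE tr N Y p q ↔ ObsIncl tr N Y p q) := by
  refine ⟨?_, fun hC => ?_, obsLE_iff_obsIncl⟩
  · rw [← Set.inter_univ (unifiedLogic N Y)]
    exact logicLE_iff_obsLE .univ (fun _ => Set.mem_univ _) hp hq
  · refine logicLE_iff_obsLE .finitary (fun hN => ?_) hp hq
    have := hC hN
    exact HML.finitary_nonzero

theorem mainTheorem3 {Act P : Type*} (tr : P → Act → P → Prop) (N : Constraint) (Y : SemKind)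
    (p q : P) (hp : ImageFinite tr p) (hq : ImageFinite tr q) :
    (LogicLE tr (unifiedLogic N Y) p q ↔ ObsLE tr N Y p q) ∧
    ((N = Constraint.C → Finite Act) →
      (LogicLE tr (finitaryLogic N Y) p q ↔ ObsLE tr N Y p q)) ∧
    (ObsLE tr N Y p q ↔ ObsIncl tr N Y p q) :=
  mainTheorem3_general tr N Y p q (fun _ => hp) hq
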